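/- **Conventions.** Composition is written in diagrammatic order. We work in ordinary (set-based) category theory; categories and displayed categories need not be univalent. *Displayed categories.* A displayed category $D$ over a category $C$ has objects over each $x\in C$ and, for $f:x\to y$ and $A,B$ over $x,y$, a set of morphisms $A\to_f B$ over $f$, with identities and composition lying over those of $C$ and satisfying the associativity and unit laws over those of $C$. The fiber $D[x]$ has the objects over $x$ and the morphisms over $\mathrm{id}_x$. A displayed functor $\overline F:D\to D'$ over $F:C\to C'$, and a displayed natural transformation over a natural transformation $\tau$, act on objects and morphisms over those of $C$ and satisfy the usual laws over those of $F$, $\tau$. A displayed functor over $F$ induces functors $\overline F_x:D[x]\to D'[Fx]$. A morphism $\overline f:A\to_f B$ over $f:x\to y$ is Cartesian if every $\overline h:E\to_{g\cdot f}B$ factors as $\overline g\cdot\overline f$ for a unique $\overline g:E\to_g A$. A cleaving is a choice of a Cartesian lift $f^*B\to_f B$ for every $f:x\to y$ and $B$ over $y$; it induces substitution functors $f^*:D[y]\to D[x]$. A displayed functor is Cartesian if it preserves Cartesian morphisms. The displayed arrow category $\mathrm{Arr}(C)$ has as objects over $y$ the arrows with codomain $y$ and as morphisms over $f$ the commuting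 squares with bottom side $f$; a functor $F:C_1\to C_2$ induces a displayed functor $\mathrm{Arr}(F)$ over $F$, and a natural transformation $\tau$ induces $\mathrm{Arr}(\tau)$ over $\tau$. *Objects.* A full comprehension category $\chi:D\to\mathrm{Arr}(C)$ consists of a category $C$ with a terminal object $\diamond$, a displayed category $D$ over $C$ with a cleaving, and a Cartesian, fully faithful displayed functor $\chi$ over $\mathrm{id}_C$. For $A$ over $\Gamma$ we write $\chi(A)$ as $\pi_A:\Gamma.A\to\Gamma$. It is a *DFL comprehension category* if moreover: - every fiber $D[\Gamma]$ has a terminal object, binary products and equalizers, and all substitution functors preserve these; - $\pi_{1_\Gamma}:\Gamma.1_\Gamma\to\Gamma$ is an isomorphism for every $\Gamma$, where $1_\Gamma$ is terminal in $D[\Gamma]$; - (strong $\Sigma$-types) every $\pi_A^*:D[\Gamma]\to D[\Gamma.A]$ has a left adjoint $\Sigma_A$, with unit $\eta$, such that the Beck–Chevalley condition holds for every pullback square with vertical sides $\pi_A:\Gamma.A\to\Gamma$, $\pi_B:\Delta.B\to\Delta$ and horizontal sides $s':\Gamma.A\to\Delta.B$, $s:\Gamma\to\Delta$ (the canonical map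 $\Sigma_A(s'^*E)\to s^*(\Sigma_BE)$ is an isomorphism for all $E$ over $\Delta.B$), and such that for all $A$ over $\Gamma$ and $B$ over $\Gamma.A$ the map $\Gamma.A.B\to\Gamma.A.\pi_A^*(\Sigma_AB)\to\Gamma.\Sigma_AB$, given by $\eta_B$ followed by the Cartesian lift of $\pi_A$, is an isomorphism; - (democracy) every $\Gamma\in C$ is isomorphic to $\diamond.A$ for some $A$ over $\diamond$. *The bicategory $\mathsf{DFLCompCat}$.* Its objects are DFL comprehension categories. A 1-cell from $\chi_1:D_1\to\mathrm{Arr}(C_1)$ to $\chi_2:D_2\to\mathrm{Arr}(C_2)$ is a triple $(F,\overline F,F_\chi)$ of a functor $F:C_1\to C_2$ preserving terminal objects, a Cartesian displayed functor $\overline F:D_1\to D_2$ over $F$ such that each $\overline F_x$ preserves terminal objects, binary products and equalizers, and a displayed natural isomorphism $F_\chi:\chi_1\cdot\mathrm{Arr}(F)\Rightarrow\overline F\cdot\chi_2$ over the identity of $F$. A 2-cell $(F,\overline F,F_\chi)\Rightarrow(G,\overline G,G_\chi)$ is a natural transformation $\tau:F\Rightarrow G$ with a displayed natural transformation $\overline\tau:\overline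 F\Rightarrow\overline G$ over $\tau$ such that, for all $A$ over $\Gamma$, the morphisms $F_\chi(A)\cdot\chi_2(\overline\tau_A)$ and $\mathrm{Arr}(\tau)_{\chi_1(A)}\cdot G_\chi(A)$ are equal. Identities, compositions, whiskerings, associators and unitors are the evident componentwise ones. **Proposition.** Let $(F,\overline F,F_\chi)$ be a 1-cell in $\mathsf{DFLCompCat}$ from $\chi_1:D_1\to\mathrm{Arr}(C_1)$ to $\chi_2:D_2\to\mathrm{Arr}(C_2)$. Suppose that - $F$ is an adjoint equivalence of categories, i.e. we are given an adjunction $F\dashv G$ whose unit $\eta$ and counit $\varepsilon$ are isomorphisms, and - $\overline F$ is a displayed adjoint equivalence over it, i.e. we are given a displayed functor $\overline G:D_2\to D_1$ over $G$ and displayed natural isomorphisms $\overline\eta:\mathrm{id}\Rightarrow\overline F\cdot\overline G$ over $\eta$ and $\overline\varepsilon:\overline G\cdot\overline F\Rightarrow\mathrm{id}$ over $\varepsilon$ that satisfy the two triangle laws. Then $(F,\overline F,F_\chi)$ is an adjoint equivalence in the bicategory $\mathsf{DFLCompCat}$: it is the left adjoint of an adjunction in $\mathsf{DFLCompCat}$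 whose unit and counit are invertible 2-cells. -/

import Mathlib

open CategoryTheory CategoryTheory.Limits

universe v u w z v₁ u₁ w₁ z₁ v₂ u₂ w₂ z₂ v₃ u₃ w₃ z₃ v₄ u₄ w₄ z₄

namespace DFL

/-! ### Displayed categories -/

/-- A displayed category over `C`.  The laws compare morphisms over the two sides of the
corresponding law of `C`, so they are heterogeneous equalities (equivalently, equalities up to
transport along the law of `C`). -/
structure DispCat (C : Type u) [Category.{v} C] where
  /-- objects over `x` -/
  Obj : C → Type z
  /-- morphisms over `f` -/
  Hom : {x y : C} → (x ⟶ y) → Obj x → Obj y → Type w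
  id : {x : C} → (A : Obj x) → Hom (𝟙 x) A A
  /-- composition, in diagrammatic order -/
  comp : {x y t : C} → {f : x ⟶ y} → {g : y ⟶ t} → {A : Obj x} → {B : Obj y} → {E : Obj t} →
    Hom f A B → Hom g B E → Hom (f ≫ g) A E
  id_comp : ∀ {x y : C} {f : x ⟶ y} {A : Obj x} {B : Obj y} (a : Hom f A B),
    HEq (comp (id A) a) a
  comp_id : ∀ {x y : C} {f : x ⟶ y} {A : Obj x} {B : Obj y} (a : Hom f A B),
    HEq (comp a (id B)) a
  assoc : ∀ {x y t s : C} {f : x ⟶ y} {g : y ⟶ t} {h : t ⟶ s}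
    {A : Obj x} {B : Obj y} {E : Obj t} {G : Obj s}
    (a : Hom f A B) (b : Hom g B E) (c : Hom h E G),
    HEq (comp (comp a b) c) (comp a (comp b c))

section Basic

variable {C : Type u} [Category.{v} C] (D : DispCat.{v, u, w, z} C)

/-- Transport of a displayed morphism along an equality in the base. -/
def DispCat.tr {x y : C} {f g : x ⟶ y} (h : f = g) {A : D.Obj x} {B : D.Obj y}
    (a : D.Hom f A B) : D.Hom g A B := h ▸ a

/-- Objects of the total category. -/
structure DispCat.Total where
  base : C
  fib : D.Obj base

/-- Morphisms of the total category. -/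
@[ext]
structure DispCat.TotalHom (X Y : D.Total) where
  base : X.base ⟶ Y.base
  fib : D.Hom base X.fib Y.fib

/-- The total category. -/
instance DispCat.totalCategory : Category D.Total where
  Hom X Y := D.TotalHom X Y
  id _ := ⟨𝟙 _, D.id _⟩
  comp a b := ⟨a.base ≫ b.base, D.comp a.fib b.fib⟩
  id_comp _ := DispCat.TotalHom.ext (Category.id_comp _) (D.id_comp _)
  comp_id _ := DispCat.TotalHom.ext (Category.comp_id _) (D.comp_id _)
  assoc _ _ _ := DispCat.TotalHom.ext (Category.assoc _ _ _) (D.assoc _ _ _)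

/-- A displayed morphism as a morphism of the total category. -/
def DispCat.tot {x y : C} {f : x ⟶ y} {A : D.Obj x} {B : D.Obj y} (a : D.Hom f A B) :
    (⟨x, A⟩ : D.Total) ⟶ ⟨y, B⟩ := ⟨f, a⟩

variable {D}

theorem DispCat.tot_id {x : C} (A : D.Obj x) : D.tot (D.id A) = 𝟙 _ := rfl

theorem DispCat.tot_comp {x y t : C} {f : x ⟶ y} {g : y ⟶ t} {A : D.Obj x} {B : D.Obj y}
    {E : D.Obj t} (a : D.Hom f A B) (b : D.Hom g B E) :
    D.tot (D.comp a b) = D.tot a ≫ D.tot b := rfl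

theorem DispCat.tot_tr {x y : C} {f g : x ⟶ y} (h : f = g) {A : D.Obj x} {B : D.Obj y}
    (a : D.Hom f A B) : D.tot (D.tr h a) = D.tot a := by
  subst h; rfl

theorem DispCat.tot_eq {x y : C} {f g : x ⟶ y} {A : D.Obj x} {B : D.Obj y}
    {a : D.Hom f A B} {b : D.Hom g A B} (hb : f = g) (h : HEq a b) : D.tot a = D.tot b :=
  DispCat.TotalHom.ext hb h

theorem DispCat.heq_of_tot {x y : C} {f g : x ⟶ y} {A : D.Obj x} {B : D.Obj y}
    {a : D.Hom f A B} {b : D.Hom g A B} (h : D.tot a = D.tot b) : HEq a b :=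
  ((DispCat.TotalHom.ext_iff (x := D.tot a) (y := D.tot b)).1 h).2

theorem DispCat.eq_of_tot {x y : C} {f : x ⟶ y} {A : D.Obj x} {B : D.Obj y}
    {a b : D.Hom f A B} (h : D.tot a = D.tot b) : a = b :=
  eq_of_heq (DispCat.heq_of_tot h)

variable (D) in
/-- Objects of the fiber category over `x`. -/
structure DispCat.Fiber (x : C) where
  obj : D.Obj x

/-- Morphisms of the fiber category over `x`: the displayed morphisms over `𝟙 x`. -/
@[ext]
structure DispCat.FiberHom {x : C} (A B : D.Fiber x) where
  hom : D.Hom (𝟙 x) A.obj B.obj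

/-- The fiber category over `x`. -/
instance DispCat.fiberCategory (x : C) : Category.{w} (D.Fiber x) where
  Hom A B := DispCat.FiberHom A B
  id A := ⟨D.id A.obj⟩
  comp a b := ⟨D.tr (Category.id_comp (𝟙 x)) (D.comp a.hom b.hom)⟩
  id_comp _ := DispCat.FiberHom.ext (DispCat.eq_of_tot (by
    rw [DispCat.tot_tr, DispCat.tot_comp, DispCat.tot_id, Category.id_comp]))
  comp_id _ := DispCat.FiberHom.ext (DispCat.eq_of_tot (by
    rw [DispCat.tot_tr, DispCat.tot_comp, DispCat.tot_id, Category.comp_id]))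
  assoc _ _ _ := DispCat.FiberHom.ext (DispCat.eq_of_tot (by
    simp only [DispCat.tot_tr, DispCat.tot_comp, Category.assoc]))

theorem DispCat.fiber_ext {x : C} {A B : D.Fiber x} {a b : A ⟶ B}
    (h : D.tot a.hom = D.tot b.hom) : a = b :=
  DispCat.FiberHom.ext (DispCat.eq_of_tot h)

theorem DispCat.tot_fiber_id {x : C} (A : D.Fiber x) :
    D.tot (DispCat.FiberHom.hom (𝟙 A)) = 𝟙 _ := rfl

theorem DispCat.tot_fiber_comp {x : C} {A B E : D.Fiber x} (a : A ⟶ B) (b : B ⟶ E) :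
    D.tot (DispCat.FiberHom.hom (a ≫ b)) = D.tot a.hom ≫ D.tot b.hom :=
  DispCat.tot_tr _ _

/-- A displayed morphism over an isomorphism `f` is a displayed isomorphism if it has a two-sided
inverse over the inverse of `f`. -/
def DispCat.IsIsoOver {x y : C} {f : x ⟶ y} [IsIso f] {A : D.Obj x} {B : D.Obj y}
    (a : D.Hom f A B) : Prop :=
  ∃ b : D.Hom (inv f) B A, HEq (D.comp a b) (D.id A) ∧ HEq (D.comp b a) (D.id B)

/-- Cartesian displayed morphisms. -/
def DispCat.IsCartesian {x y : C} {f : x ⟶ y} {A : D.Obj x} {B : D.Obj y}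
    (a : D.Hom f A B) : Prop :=
  ∀ ⦃t : C⦄ (E : D.Obj t) (g : t ⟶ x) (h : D.Hom (g ≫ f) E B),
    ∃! k : D.Hom g E A, D.comp k a = h

/-- The unique factorisation through a Cartesian morphism. -/
noncomputable def DispCat.IsCartesian.fac {x y : C} {f : x ⟶ y} {A : D.Obj x} {B : D.Obj y}
    {a : D.Hom f A B} (ha : DispCat.IsCartesian a) {t : C} {E : D.Obj t} (g : t ⟶ x)
    (h : D.Hom (g ≫ f) E B) : D.Hom g E A :=
  (ha E g h).choose

theorem DispCat.IsCartesian.fac_comp {x y : C} {f : x ⟶ y} {A : D.Obj x} {B : D.Obj y}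
    {a : D.Hom f A B} (ha : DispCat.IsCartesian a) {t : C} {E : D.Obj t} (g : t ⟶ x)
    (h : D.Hom (g ≫ f) E B) : D.tot (ha.fac g h) ≫ D.tot a = D.tot h :=
  congrArg D.tot (ha E g h).choose_spec.1

theorem DispCat.IsCartesian.hom_ext {x y : C} {f : x ⟶ y} {A : D.Obj x} {B : D.Obj y}
    {a : D.Hom f A B} (ha : DispCat.IsCartesian a) {t : C} {E : D.Obj t} {g : t ⟶ x}
    {k k' : D.Hom g E A} (h : D.tot k ≫ D.tot a = D.tot k' ≫ D.tot a) : k = k' :=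
  (ha E g (D.comp k' a)).unique (DispCat.eq_of_tot h) rfl

variable (D) in
/-- A cleaving: a choice of Cartesian lifts. -/
structure DispCat.Cleaving where
  obj : {x y : C} → (x ⟶ y) → D.Obj y → D.Obj x
  lift : {x y : C} → (f : x ⟶ y) → (B : D.Obj y) → D.Hom f (obj f B) B
  cart : ∀ {x y : C} (f : x ⟶ y) (B : D.Obj y), DispCat.IsCartesian (lift f B)

/-- The action of substitution along `f` on a vertical morphism `b`: the unique vertical morphism
whose composite with the lift of `f` is the lift of `f` followed by `b`. -/
noncomputable def DispCat.Cleaving.reindexMap (cl : D.Cleaving) {x y : C} (f : x ⟶ y)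
    {B B' : D.Obj y} (b : D.Hom (𝟙 y) B B') : D.Hom (𝟙 x) (cl.obj f B) (cl.obj f B') :=
  (cl.cart f B').fac (𝟙 x)
    (D.tr ((Category.comp_id f).trans (Category.id_comp f).symm) (D.comp (cl.lift f B) b))

theorem DispCat.Cleaving.reindexMap_comp (cl : D.Cleaving) {x y : C} (f : x ⟶ y)
    {B B' : D.Obj y} (b : D.Hom (𝟙 y) B B') :
    D.tot (cl.reindexMap f b) ≫ D.tot (cl.lift f B') = D.tot (cl.lift f B) ≫ D.tot b := by
  rw [DispCat.Cleaving.reindexMap, DispCat.IsCartesian.fac_comp, DispCat.tot_tr,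
    DispCat.tot_comp]

/-- The substitution functor `f^* : D[y] ⥤ D[x]` along `f : x ⟶ y`. -/
noncomputable def DispCat.Cleaving.reindex (cl : D.Cleaving) {x y : C} (f : x ⟶ y) :
    D.Fiber y ⥤ D.Fiber x where
  obj B := ⟨cl.obj f B.obj⟩
  map {B B'} b := ⟨cl.reindexMap f b.hom⟩
  map_id B := DispCat.FiberHom.ext ((cl.cart f B.obj).hom_ext (by
    rw [DispCat.Cleaving.reindexMap_comp, DispCat.tot_fiber_id, DispCat.tot_fiber_id,
      Category.comp_id, Category.id_comp]))
  map_comp {B B' B''} b b' := DispCat.FiberHom.ext ((cl.cart f B''.obj).hom_ext (by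
    rw [DispCat.Cleaving.reindexMap_comp, DispCat.tot_fiber_comp, DispCat.tot_fiber_comp,
      Category.assoc, DispCat.Cleaving.reindexMap_comp, ← Category.assoc, ← Category.assoc,
      DispCat.Cleaving.reindexMap_comp]))

/-- For a commuting square `g ≫ f = g' ≫ f'`, the canonical comparison morphism
`g^* (f^* B) ⟶ g'^* (f'^* B)`: the unique morphism over the identity that commutes with the
composites of the chosen Cartesian lifts. -/
noncomputable def DispCat.Cleaving.squareApp (cl : D.Cleaving) {x y y' t : C} {g : x ⟶ y}
    {f : y ⟶ t} {g' : x ⟶ y'} {f' : y' ⟶ t} (h : g ≫ f = g' ≫ f') (B : D.Obj t) :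
    D.Hom (𝟙 x) (cl.obj g (cl.obj f B)) (cl.obj g' (cl.obj f' B)) :=
  (cl.cart g' (cl.obj f' B)).fac (𝟙 x)
    (D.tr (Category.id_comp g').symm ((cl.cart f' B).fac g'
      (D.tr h (D.comp (cl.lift g (cl.obj f B)) (cl.lift f B)))))

theorem DispCat.Cleaving.squareApp_comp (cl : D.Cleaving) {x y y' t : C} {g : x ⟶ y}
    {f : y ⟶ t} {g' : x ⟶ y'} {f' : y' ⟶ t} (h : g ≫ f = g' ≫ f') (B : D.Obj t) :
    D.tot (cl.squareApp h B) ≫ D.tot (cl.lift g' (cl.obj f' B)) ≫ D.tot (cl.lift f' B) =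
      D.tot (cl.lift g (cl.obj f B)) ≫ D.tot (cl.lift f B) := by
  rw [DispCat.Cleaving.squareApp, ← Category.assoc, DispCat.IsCartesian.fac_comp, DispCat.tot_tr,
    DispCat.IsCartesian.fac_comp, DispCat.tot_tr, DispCat.tot_comp]

theorem DispCat.Cleaving.squareApp_naturality (cl : D.Cleaving) {x y y' t : C} {g : x ⟶ y}
    {f : y ⟶ t} {g' : x ⟶ y'} {f' : y' ⟶ t} (h : g ≫ f = g' ≫ f') {B B' : D.Obj t}
    (b : D.Hom (𝟙 t) B B') :
    D.tot (cl.reindexMap g (cl.reindexMap f b)) ≫ D.tot (cl.squareApp h B') =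
      D.tot (cl.squareApp h B) ≫ D.tot (cl.reindexMap g' (cl.reindexMap f' b)) := by
  refine congrArg D.tot ((cl.cart g' (cl.obj f' B')).hom_ext
    (k := D.tr (Category.id_comp (𝟙 x))
      (D.comp (cl.reindexMap g (cl.reindexMap f b)) (cl.squareApp h B')))
    (k' := D.tr (Category.id_comp (𝟙 x))
      (D.comp (cl.squareApp h B) (cl.reindexMap g' (cl.reindexMap f' b)))) ?_) |> fun e => by
        rwa [DispCat.tot_tr, DispCat.tot_tr] at e
  refine congrArg D.tot ((cl.cart f' B').hom_ext
    (k := D.comp (D.tr (Category.id_comp (𝟙 x))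
      (D.comp (cl.reindexMap g (cl.reindexMap f b)) (cl.squareApp h B')))
      (cl.lift g' (cl.obj f' B')))
    (k' := D.comp (D.tr (Category.id_comp (𝟙 x))
      (D.comp (cl.squareApp h B) (cl.reindexMap g' (cl.reindexMap f' b))))
      (cl.lift g' (cl.obj f' B'))) ?_)
  simp only [DispCat.tot_comp, DispCat.tot_tr, Category.assoc]
  rw [DispCat.Cleaving.squareApp_comp, ← Category.assoc, DispCat.Cleaving.reindexMap_comp,
    Category.assoc, DispCat.Cleaving.reindexMap_comp,
    ← Category.assoc (D.tot (cl.reindexMap g' _)), DispCat.Cleaving.reindexMap_comp,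
    Category.assoc, DispCat.Cleaving.reindexMap_comp]
  have s1 := cl.squareApp_comp h B
  rw [← Category.assoc, ← Category.assoc, ← s1]
  simp only [Category.assoc]

/-- The natural transformation `f^* ⋙ g^* ⟶ f'^* ⋙ g'^*` induced by a commuting square. -/
noncomputable def DispCat.Cleaving.squareHom (cl : D.Cleaving) {x y y' t : C} {g : x ⟶ y}
    {f : y ⟶ t} {g' : x ⟶ y'} {f' : y' ⟶ t} (h : g ≫ f = g' ≫ f') :
    cl.reindex f ⋙ cl.reindex g ⟶ cl.reindex f' ⋙ cl.reindex g' where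
  app B := ⟨cl.squareApp h B.obj⟩
  naturality _ _ b := DispCat.fiber_ext
    ((DispCat.tot_tr _ _).trans ((cl.squareApp_naturality h b.hom).trans (DispCat.tot_tr _ _).symm))

/-- `D` has fiberwise limits of shape `J`: every fiber category has limits of shape `J` and all
substitution functors preserve them. -/
def DispCat.Cleaving.HasFiberwiseLimits (cl : D.Cleaving) (J : Type) [SmallCategory J] : Prop :=
  (∀ x : C, HasLimitsOfShape J (D.Fiber x)) ∧
    ∀ {x y : C} (f : x ⟶ y), PreservesLimitsOfShape J (cl.reindex f)

end Basic

/-! ### Displayed functors and displayed natural transformations -/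

section Functors

variable {C₁ : Type u₁} [Category.{v₁} C₁] {C₂ : Type u₂} [Category.{v₂} C₂]
  {C₃ : Type u₃} [Category.{v₃} C₃]

/-- A displayed functor over `F`. -/
structure DispFunctor (F : C₁ ⥤ C₂) (D₁ : DispCat.{v₁, u₁, w₁, z₁} C₁)
    (D₂ : DispCat.{v₂, u₂, w₂, z₂} C₂) where
  obj : {x : C₁} → D₁.Obj x → D₂.Obj (F.obj x)
  map : {x y : C₁} → {f : x ⟶ y} → {A : D₁.Obj x} → {B : D₁.Obj y} →
    D₁.Hom f A B → D₂.Hom (F.map f) (obj A) (obj B)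
  map_id : ∀ {x : C₁} (A : D₁.Obj x), HEq (map (D₁.id A)) (D₂.id (obj A))
  map_comp : ∀ {x y t : C₁} {f : x ⟶ y} {g : y ⟶ t} {A : D₁.Obj x} {B : D₁.Obj y}
    {E : D₁.Obj t} (a : D₁.Hom f A B) (b : D₁.Hom g B E),
    HEq (map (D₁.comp a b)) (D₂.comp (map a) (map b))

variable {D₁ : DispCat.{v₁, u₁, w₁, z₁} C₁} {D₂ : DispCat.{v₂, u₂, w₂, z₂} C₂}
  {D₃ : DispCat.{v₃, u₃, w₃, z₃} C₃}

theorem DispFunctor.tot_map_id {F : C₁ ⥤ C₂} (P : DispFunctor F D₁ D₂) {x : C₁}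
    (A : D₁.Obj x) : D₂.tot (P.map (D₁.id A)) = 𝟙 _ :=
  DispCat.tot_eq (F.map_id x) (P.map_id A)

theorem DispFunctor.tot_map_comp {F : C₁ ⥤ C₂} (P : DispFunctor F D₁ D₂) {x y t : C₁}
    {f : x ⟶ y} {g : y ⟶ t} {A : D₁.Obj x} {B : D₁.Obj y} {E : D₁.Obj t}
    (a : D₁.Hom f A B) (b : D₁.Hom g B E) :
    D₂.tot (P.map (D₁.comp a b)) = D₂.tot (P.map a) ≫ D₂.tot (P.map b) :=
  DispCat.tot_eq (F.map_comp f g) (P.map_comp a b)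

theorem DispFunctor.tot_map_congr {F : C₁ ⥤ C₂} (P : DispFunctor F D₁ D₂) {x y : C₁}
    {f g : x ⟶ y} {A : D₁.Obj x} {B : D₁.Obj y} {a : D₁.Hom f A B} {b : D₁.Hom g A B}
    (h : D₁.tot a = D₁.tot b) : D₂.tot (P.map a) = D₂.tot (P.map b) := by
  obtain rfl : f = g := congrArg DispCat.TotalHom.base h
  rw [DispCat.eq_of_tot h]

/-- The identity displayed functor. -/
def DispFunctor.id (D : DispCat.{v₁, u₁, w₁, z₁} C₁) : DispFunctor (𝟭 C₁) D D where
  obj A := A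
  map a := a
  map_id _ := HEq.rfl
  map_comp _ _ := HEq.rfl

/-- Composition of displayed functors. -/
def DispFunctor.comp {F : C₁ ⥤ C₂} {G : C₂ ⥤ C₃} (P : DispFunctor F D₁ D₂)
    (Q : DispFunctor G D₂ D₃) : DispFunctor (F ⋙ G) D₁ D₃ where
  obj A := Q.obj (P.obj A)
  map a := Q.map (P.map a)
  map_id A := DispCat.heq_of_tot
    ((Q.tot_map_congr (DispCat.tot_eq (F.map_id _) (P.map_id A))).trans (Q.tot_map_id _))
  map_comp a b := DispCat.heq_of_tot
    ((Q.tot_map_congr (DispCat.tot_eq (F.map_comp _ _) (P.map_comp a b))).trans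
      (Q.tot_map_comp _ _))

/-- Cartesian displayed functors. -/
def DispFunctor.IsCartesian {F : C₁ ⥤ C₂} (P : DispFunctor F D₁ D₂) : Prop :=
  ∀ ⦃x y : C₁⦄ ⦃f : x ⟶ y⦄ ⦃A : D₁.Obj x⦄ ⦃B : D₁.Obj y⦄ (a : D₁.Hom f A B),
    DispCat.IsCartesian a → DispCat.IsCartesian (P.map a)

/-- A displayed functor is fully faithful if it is bijective on the morphisms over every `f`
(here the base functor is arbitrary, so this is fully faithfulness relative to it). -/
def DispFunctor.FullyFaithful {F : C₁ ⥤ C₂} (P : DispFunctor F D₁ D₂) : Prop :=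
  ∀ ⦃x y : C₁⦄ (f : x ⟶ y) (A : D₁.Obj x) (B : D₁.Obj y),
    Function.Bijective (fun a : D₁.Hom f A B => P.map a)

/-- The functor induced on the fiber over `x`. -/
def DispFunctor.fiber {F : C₁ ⥤ C₂} (P : DispFunctor F D₁ D₂) (x : C₁) :
    D₁.Fiber x ⥤ D₂.Fiber (F.obj x) where
  obj A := ⟨P.obj A.obj⟩
  map a := ⟨D₂.tr (F.map_id x) (P.map a.hom)⟩
  map_id A := DispCat.fiber_ext ((DispCat.tot_tr _ _).trans (P.tot_map_id A.obj))
  map_comp a b := DispCat.fiber_ext <| by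
    rw [DispCat.tot_fiber_comp, DispCat.tot_tr, DispCat.tot_tr, DispCat.tot_tr,
      ← DispFunctor.tot_map_comp]
    exact P.tot_map_congr (DispCat.tot_fiber_comp a b)

/-- All the functors between fibers induced by `P` preserve limits of shape `J`. -/
def DispFunctor.PreservesFiberwiseLimits {F : C₁ ⥤ C₂} (P : DispFunctor F D₁ D₂)
    (J : Type) [SmallCategory J] : Prop :=
  ∀ x : C₁, PreservesLimitsOfShape J (P.fiber x)

theorem DispFunctor.PreservesFiberwiseLimits.id (D : DispCat.{v₁, u₁, w₁, z₁} C₁)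
    (J : Type) [SmallCategory J] : (DispFunctor.id D).PreservesFiberwiseLimits J := fun x =>
  preservesLimitsOfShape_of_natIso (F := 𝟭 (D.Fiber x))
    (NatIso.ofComponents (fun A => Iso.refl A) (fun {A B} a => by
      refine (Category.comp_id a).trans (Eq.trans ?_ (Category.id_comp _).symm)
      exact DispCat.fiber_ext (DispCat.tot_tr ((𝟭 C₁).map_id x) a.hom).symm))

theorem DispFunctor.PreservesFiberwiseLimits.comp {F : C₁ ⥤ C₂} {G : C₂ ⥤ C₃}
    {P : DispFunctor F D₁ D₂} {Q : DispFunctor G D₂ D₃} {J : Type} [SmallCategory J]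
    (hP : P.PreservesFiberwiseLimits J) (hQ : Q.PreservesFiberwiseLimits J) :
    (P.comp Q).PreservesFiberwiseLimits J := fun x =>
  haveI := hP x
  haveI := hQ (F.obj x)
  preservesLimitsOfShape_of_natIso (F := P.fiber x ⋙ Q.fiber (F.obj x))
    (NatIso.ofComponents (fun A => Iso.refl (⟨Q.obj (P.obj A.obj)⟩ : D₃.Fiber _))
      (fun {A B} a => by
        refine (Category.comp_id _).trans (Eq.trans ?_ (Category.id_comp _).symm)
        refine DispCat.fiber_ext ((DispCat.tot_tr _ _).trans (Eq.trans ?_ (DispCat.tot_tr _ _).symm))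
        exact Q.tot_map_congr (DispCat.tot_tr _ _)))

/-- A displayed natural transformation over `τ`. -/
structure DispNatTrans {F G : C₁ ⥤ C₂} (τ : F ⟶ G) (P : DispFunctor F D₁ D₂)
    (Q : DispFunctor G D₁ D₂) where
  app : {x : C₁} → (A : D₁.Obj x) → D₂.Hom (τ.app x) (P.obj A) (Q.obj A)
  naturality : ∀ {x y : C₁} {f : x ⟶ y} {A : D₁.Obj x} {B : D₁.Obj y} (a : D₁.Hom f A B),
    HEq (D₂.comp (P.map a) (app B)) (D₂.comp (app A) (Q.map a))

/-- A displayed natural transformation over a natural isomorphism is a displayed natural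
isomorphism if all its components are displayed isomorphisms. -/
def DispNatTrans.IsIsoOver {F G : C₁ ⥤ C₂} {τ : F ⟶ G} [IsIso τ] {P : DispFunctor F D₁ D₂}
    {Q : DispFunctor G D₁ D₂} (α : DispNatTrans τ P Q) : Prop :=
  ∀ ⦃x : C₁⦄ (A : D₁.Obj x), DispCat.IsIsoOver (α.app A)

/-- An adjoint equivalence of categories with left adjoint `F`. -/
structure AdjointEquivalence (F : C₁ ⥤ C₂) where
  inverse : C₂ ⥤ C₁
  adj : F ⊣ inverse
  unit_isIso : IsIso adj.unit
  counit_isIso : IsIso adj.counit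

attribute [instance] AdjointEquivalence.unit_isIso AdjointEquivalence.counit_isIso

/-- A displayed adjoint equivalence with left adjoint `P`, over an adjoint equivalence `e`. -/
structure DispAdjointEquivalence {F : C₁ ⥤ C₂} (P : DispFunctor F D₁ D₂)
    (e : AdjointEquivalence F) where
  inverse : DispFunctor e.inverse D₂ D₁
  unit : DispNatTrans e.adj.unit (DispFunctor.id D₁) (P.comp inverse)
  counit : DispNatTrans e.adj.counit (inverse.comp P) (DispFunctor.id D₂)
  unit_isIso : unit.IsIsoOver
  counit_isIso : counit.IsIsoOver
  left_triangle : ∀ {x : C₁} (A : D₁.Obj x),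
    HEq (D₂.comp (P.map (unit.app A)) (counit.app (P.obj A))) (D₂.id (P.obj A))
  right_triangle : ∀ {y : C₂} (B : D₂.Obj y),
    HEq (D₁.comp (unit.app (inverse.obj B)) (inverse.map (counit.app B)))
      (D₁.id (inverse.obj B))

end Functors

/-! ### The displayed arrow category -/

section Arrow

/-- Commuting squares with bottom side `f`, left side `A` and right side `B`. -/
structure ArrHom {C : Type u} [Category.{v} C] {x y : C} (f : x ⟶ y) (A : Over x) (B : Over y) where
  top : A.left ⟶ B.left
  w : top ≫ B.hom = A.hom ≫ f

theorem ArrHom.heq {C : Type u} [Category.{v} C] {x y : C} {f g : x ⟶ y} {A : Over x}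
    {B : Over y} {a : ArrHom f A B} {b : ArrHom g A B} (h : f = g) (h' : a.top = b.top) :
    HEq a b := by
  subst h
  cases a; cases b; cases h'; rfl

theorem ArrHom.ext {C : Type u} [Category.{v} C] {x y : C} {f : x ⟶ y} {A : Over x}
    {B : Over y} {a b : ArrHom f A B} (h' : a.top = b.top) : a = b :=
  eq_of_heq (ArrHom.heq rfl h')

/-- The displayed category of arrows of `C`: objects over `y` are arrows with codomain `y`,
morphisms over `f` are commuting squares with bottom side `f`. -/
def arr (C : Type u) [Category.{v} C] : DispCat.{v, u, v, max u v} C where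
  Obj y := Over y
  Hom f A B := ArrHom f A B
  id A := ⟨𝟙 A.left, (Category.id_comp _).trans (Category.comp_id _).symm⟩
  comp a b := ⟨a.top ≫ b.top, by
    rw [Category.assoc, b.w, ← Category.assoc, a.w, Category.assoc]⟩
  id_comp _ := ArrHom.heq (Category.id_comp _) (Category.id_comp _)
  comp_id _ := ArrHom.heq (Category.comp_id _) (Category.comp_id _)
  assoc _ _ _ := ArrHom.heq (Category.assoc _ _ _) (Category.assoc _ _ _)

/-- The displayed functor between arrow categories induced by `F`. -/
def arrFunctor {C₁ : Type u₁} [Category.{v₁} C₁] {C₂ : Type u₂} [Category.{v₂} C₂]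
    (F : C₁ ⥤ C₂) : DispFunctor F (arr C₁) (arr C₂) where
  obj A := Over.mk (F.map A.hom)
  map a := ⟨F.map a.top, by
    change F.map a.top ≫ F.map _ = F.map _ ≫ F.map _
    rw [← F.map_comp, a.w, F.map_comp]⟩
  map_id _ := ArrHom.heq (F.map_id _) (F.map_id _)
  map_comp _ _ := ArrHom.heq (F.map_comp _ _) (F.map_comp _ _)

/-- The displayed natural transformation between arrow functors induced by `τ`. -/
def arrNatTrans {C₁ : Type u₁} [Category.{v₁} C₁] {C₂ : Type u₂} [Category.{v₂} C₂]
    {F G : C₁ ⥤ C₂} (τ : F ⟶ G) : DispNatTrans τ (arrFunctor F) (arrFunctor G) where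
  app A := ⟨τ.app A.left, (τ.naturality A.hom).symm⟩
  naturality a := ArrHom.heq (τ.naturality _) (τ.naturality a.top)

end Arrow

theorem arr_top_eq {C : Type u} [Category.{v} C] {x y : C} {f g : x ⟶ y} {A : Over x}
    {B : Over y} {a : ArrHom f A B} {b : ArrHom g A B} (hfg : f = g) (h : HEq a b) :
    a.top = b.top := by
  subst hfg; cases h; rfl

theorem arr_isIsoOver {C : Type u} [Category.{v} C] {x y : C} {f : x ⟶ y} [IsIso f] {A : Over x}
    {B : Over y} (a : ArrHom f A B) (h : IsIso a.top) :
    DispCat.IsIsoOver (D := arr C) (A := A) (B := B) a := by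
  refine ⟨⟨inv a.top, ?_⟩, ArrHom.heq (IsIso.hom_inv_id f) (IsIso.hom_inv_id a.top),
    ArrHom.heq (IsIso.inv_hom_id f) (IsIso.inv_hom_id a.top)⟩
  rw [IsIso.inv_comp_eq, ← Category.assoc, IsIso.eq_comp_inv, a.w]

theorem arr_isIso_top {C : Type u} [Category.{v} C] {x y : C} {f : x ⟶ y} [IsIso f] {A : Over x}
    {B : Over y} {a : ArrHom f A B} (h : DispCat.IsIsoOver (D := arr C) (A := A) (B := B) a) :
    IsIso a.top := by
  obtain ⟨b, h₁, h₂⟩ := h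
  exact ⟨b.top, arr_top_eq (IsIso.hom_inv_id f) h₁, arr_top_eq (IsIso.inv_hom_id f) h₂⟩

/-! ### Full comprehension categories -/

/-- A full comprehension category: a category of contexts with a terminal object, a displayed
category of types with a cleaving, and a Cartesian fully faithful displayed functor over the
identity to the displayed arrow category.  No univalence condition is imposed. -/
structure FullCompCat where
  /-- the category of contexts -/
  Ctx : Type u
  [cat : Category.{v} Ctx]
  [hasTerminal : HasTerminal Ctx]
  /-- the displayed category of types -/
  Ty : DispCat.{v, u, w, z} Ctx
  cl : Ty.Cleaving
  /-- the comprehension functor -/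
  χ : DispFunctor (𝟭 Ctx) Ty (arr Ctx)
  χ_cartesian : χ.IsCartesian
  full : χ.FullyFaithful

attribute [instance] FullCompCat.cat FullCompCat.hasTerminal

namespace FullCompCat

section Ext

variable (X : FullCompCat.{v, u, w, z})

/-- Context extension `Γ.A`. -/
def ext {Γ : X.Ctx} (A : X.Ty.Obj Γ) : X.Ctx := Comma.left (X.χ.obj A : Over Γ)

/-- The projection `Γ.A ⟶ Γ`. -/
def proj {Γ : X.Ctx} (A : X.Ty.Obj Γ) : X.ext A ⟶ Γ := Comma.hom (X.χ.obj A : Over Γ)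

/-- The action of comprehension on morphisms. -/
def extMap {Γ Δ : X.Ctx} {s : Γ ⟶ Δ} {A : X.Ty.Obj Γ} {B : X.Ty.Obj Δ} (a : X.Ty.Hom s A B) :
    X.ext A ⟶ X.ext B := ArrHom.top (X.χ.map a)

variable {X}

theorem extMap_proj {Γ Δ : X.Ctx} {s : Γ ⟶ Δ} {A : X.Ty.Obj Γ} {B : X.Ty.Obj Δ}
    (a : X.Ty.Hom s A B) : X.extMap a ≫ X.proj B = X.proj A ≫ s := ArrHom.w (X.χ.map a)

theorem extMap_id {Γ : X.Ctx} (A : X.Ty.Obj Γ) : X.extMap (X.Ty.id A) = 𝟙 _ :=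
  arr_top_eq rfl (X.χ.map_id A)

theorem extMap_comp {Γ Δ Θ : X.Ctx} {s : Γ ⟶ Δ} {t : Δ ⟶ Θ} {A : X.Ty.Obj Γ} {B : X.Ty.Obj Δ}
    {E : X.Ty.Obj Θ} (a : X.Ty.Hom s A B) (b : X.Ty.Hom t B E) :
    X.extMap (X.Ty.comp a b) = X.extMap a ≫ X.extMap b :=
  arr_top_eq rfl (X.χ.map_comp a b)

theorem extMap_congr {Γ Δ : X.Ctx} {s t : Γ ⟶ Δ} {A : X.Ty.Obj Γ} {B : X.Ty.Obj Δ}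
    {a : X.Ty.Hom s A B} {b : X.Ty.Hom t A B} (h : X.Ty.tot a = X.Ty.tot b) :
    X.extMap a = X.extMap b := by
  obtain rfl : s = t := congrArg DispCat.TotalHom.base h
  rw [DispCat.eq_of_tot h]

end Ext

/-- A pseudo morphism of full comprehension categories. -/
structure PseudoMor (X : FullCompCat.{v₁, u₁, w₁, z₁}) (Y : FullCompCat.{v₂, u₂, w₂, z₂}) where
  functor : X.Ctx ⥤ Y.Ctx
  preservesTerminal : PreservesLimitsOfShape (Discrete PEmpty.{1}) functor
  ty : DispFunctor functor X.Ty Y.Ty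
  cartesian : ty.IsCartesian
  /-- the displayed natural transformation filling the square with the comprehension functors;
  it lies over the identity `𝟭 ⋙ F ≅ F ⋙ 𝟭` of the functor `F` -/
  comm : DispNatTrans (functor.leftUnitor ≪≫ functor.rightUnitor.symm).hom
    (X.χ.comp (arrFunctor functor)) (ty.comp Y.χ)
  comm_isIso : comm.IsIsoOver

namespace PseudoMor

section

variable {X : FullCompCat.{v₁, u₁, w₁, z₁}} {Y : FullCompCat.{v₂, u₂, w₂, z₂}}

/-- The component `F(Γ.A) ⟶ (F Γ).(F A)` of the comparison transformation. -/
def commTop (F : PseudoMor X Y) {Γ : X.Ctx} (A : X.Ty.Obj Γ) :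
    F.functor.obj (X.ext A) ⟶ Y.ext (F.ty.obj A) := ArrHom.top (F.comm.app A)

theorem commTop_proj (F : PseudoMor X Y) {Γ : X.Ctx} (A : X.Ty.Obj Γ) :
    F.commTop A ≫ Y.proj (F.ty.obj A) = F.functor.map (X.proj A) :=
  (ArrHom.w (F.comm.app A)).trans
    ((congrArg (F.functor.map (X.proj A) ≫ ·) (Category.comp_id _)).trans (Category.comp_id _))

theorem comm_base {C₁ : Type u₁} [Category.{v₁} C₁] {C₂ : Type u₂} [Category.{v₂} C₂]
    (F : C₁ ⥤ C₂) {x y : C₁} (f : x ⟶ y) :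
    F.map f ≫ (F.leftUnitor ≪≫ F.rightUnitor.symm).hom.app y =
      (F.leftUnitor ≪≫ F.rightUnitor.symm).hom.app x ≫ F.map f := by
  simp

theorem commTop_naturality (F : PseudoMor X Y) {Γ Δ : X.Ctx} {s : Γ ⟶ Δ} {A : X.Ty.Obj Γ}
    {B : X.Ty.Obj Δ} (a : X.Ty.Hom s A B) :
    F.functor.map (X.extMap a) ≫ F.commTop B = F.commTop A ≫ Y.extMap (F.ty.map a) :=
  arr_top_eq (comm_base F.functor s) (F.comm.naturality a)

instance (F : PseudoMor X Y) {Γ : X.Ctx} (A : X.Ty.Obj Γ) : IsIso (F.commTop A) :=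
  arr_isIso_top (F.comm_isIso A)

/-- Constructing the comparison transformation from its components. -/
def mkComm {F : X.Ctx ⥤ Y.Ctx} (P : DispFunctor F X.Ty Y.Ty)
    (t : ∀ {Γ : X.Ctx} (A : X.Ty.Obj Γ), F.obj (X.ext A) ⟶ Y.ext (P.obj A))
    (ht : ∀ {Γ : X.Ctx} (A : X.Ty.Obj Γ), t A ≫ Y.proj (P.obj A) = F.map (X.proj A))
    (hn : ∀ {Γ Δ : X.Ctx} {s : Γ ⟶ Δ} {A : X.Ty.Obj Γ} {B : X.Ty.Obj Δ} (a : X.Ty.Hom s A B),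
      F.map (X.extMap a) ≫ t B = t A ≫ Y.extMap (P.map a)) :
    DispNatTrans (F.leftUnitor ≪≫ F.rightUnitor.symm).hom
      (X.χ.comp (arrFunctor F)) (P.comp Y.χ) where
  app A := ⟨t A, (ht A).trans
    ((congrArg (F.map (X.proj A) ≫ ·) (Category.comp_id _)).trans (Category.comp_id _)).symm⟩
  naturality a := ArrHom.heq (comm_base F _) (hn a)

theorem mkComm_isIso {F : X.Ctx ⥤ Y.Ctx} (P : DispFunctor F X.Ty Y.Ty)
    (t : ∀ {Γ : X.Ctx} (A : X.Ty.Obj Γ), F.obj (X.ext A) ⟶ Y.ext (P.obj A))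
    (ht : ∀ {Γ : X.Ctx} (A : X.Ty.Obj Γ), t A ≫ Y.proj (P.obj A) = F.map (X.proj A))
    (hn : ∀ {Γ Δ : X.Ctx} {s : Γ ⟶ Δ} {A : X.Ty.Obj Γ} {B : X.Ty.Obj Δ} (a : X.Ty.Hom s A B),
      F.map (X.extMap a) ≫ t B = t A ≫ Y.extMap (P.map a))
    (hi : ∀ {Γ : X.Ctx} (A : X.Ty.Obj Γ), IsIso (t A)) : (mkComm P t ht hn).IsIsoOver :=
  fun _ A => arr_isIsoOver _ (hi A)

end

/-- The identity pseudo morphism. -/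
def id (X : FullCompCat.{v, u, w, z}) : PseudoMor X X where
  functor := 𝟭 X.Ctx
  preservesTerminal := inferInstance
  ty := DispFunctor.id X.Ty
  cartesian _ _ _ _ _ _ h := h
  comm := mkComm (DispFunctor.id X.Ty) (fun A => 𝟙 (X.ext A)) (fun _ => Category.id_comp _)
    (fun _ => (Category.comp_id _).trans (Category.id_comp _).symm)
  comm_isIso := mkComm_isIso _ _ _ _ (fun A => (inferInstance : IsIso (𝟙 (X.ext A))))

/-- Composition of pseudo morphisms. -/
def comp {X : FullCompCat.{v₁, u₁, w₁, z₁}} {Y : FullCompCat.{v₂, u₂, w₂, z₂}}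
    {Z : FullCompCat.{v₃, u₃, w₃, z₃}} (F : PseudoMor X Y) (G : PseudoMor Y Z) :
    PseudoMor X Z where
  functor := F.functor ⋙ G.functor
  preservesTerminal :=
    haveI := F.preservesTerminal
    haveI := G.preservesTerminal
    inferInstance
  ty := F.ty.comp G.ty
  cartesian _ _ _ _ _ a h := G.cartesian _ (F.cartesian a h)
  comm := mkComm (F.ty.comp G.ty)
    (fun A => G.functor.map (F.commTop A) ≫ G.commTop (F.ty.obj A))
    (fun A => (Category.assoc _ _ _).trans <| (congrArg (_ ≫ ·) (G.commTop_proj _)).trans <|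
      (G.functor.map_comp _ _).symm.trans (congrArg G.functor.map (F.commTop_proj A)))
    (fun {Γ Δ s A B} a => by
      have e₁ := congrArg G.functor.map (F.commTop_naturality a)
      rw [G.functor.map_comp, G.functor.map_comp] at e₁
      have e₂ := G.commTop_naturality (F.ty.map a)
      exact (Category.assoc _ _ _).symm.trans <| (congrArg (· ≫ _) e₁).trans <|
        (Category.assoc _ _ _).trans <| (congrArg (_ ≫ ·) e₂).trans (Category.assoc _ _ _).symm)
  comm_isIso := mkComm_isIso _ _ _ _ (fun A =>
    (inferInstance : IsIso (G.functor.map (F.commTop A) ≫ G.commTop (F.ty.obj A))))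

/-- A 2-cell between pseudo morphisms. -/
structure Cell {X : FullCompCat.{v₁, u₁, w₁, z₁}} {Y : FullCompCat.{v₂, u₂, w₂, z₂}}
    (F G : PseudoMor X Y) where
  nat : F.functor ⟶ G.functor
  ty : DispNatTrans nat F.ty G.ty
  /-- compatibility with the comparison transformations, at a type `A`, as an equality of
  morphisms `F(Γ.A) ⟶ (G Γ).(G A)` -/
  comm : ∀ {Γ : X.Ctx} (A : X.Ty.Obj Γ),
    F.commTop A ≫ Y.extMap (ty.app A) = nat.app (X.ext A) ≫ G.commTop A

section

variable {X : FullCompCat.{v₁, u₁, w₁, z₁}} {Y : FullCompCat.{v₂, u₂, w₂, z₂}}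
  {Z : FullCompCat.{v₃, u₃, w₃, z₃}} {W : FullCompCat.{v₄, u₄, w₄, z₄}}

theorem Cell.ext {F G : PseudoMor X Y} {α β : Cell F G}
    (h₁ : ∀ Γ : X.Ctx, α.nat.app Γ = β.nat.app Γ)
    (h₂ : ∀ {Γ : X.Ctx} (A : X.Ty.Obj Γ), Y.Ty.tot (α.ty.app A) = Y.Ty.tot (β.ty.app A)) :
    α = β := by
  obtain ⟨n, ⟨a, ha⟩, c⟩ := α
  obtain ⟨n', ⟨b, hb⟩, c'⟩ := β
  obtain rfl : n = n' := NatTrans.ext (funext h₁)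
  obtain rfl : @a = @b := by
    funext Γ A
    exact DispCat.eq_of_tot (h₂ A)
  rfl

/-- The identity 2-cell. -/
def Cell.id (F : PseudoMor X Y) : Cell F F where
  nat := 𝟙 F.functor
  ty := ⟨fun A => Y.Ty.id (F.ty.obj A), fun a => DispCat.heq_of_tot
    ((Category.comp_id (Y.Ty.tot (F.ty.map a))).trans
      (Category.id_comp (Y.Ty.tot (F.ty.map a))).symm)⟩
  comm A := (congrArg (_ ≫ ·) (extMap_id _)).trans
    ((Category.comp_id (F.commTop A)).trans (Category.id_comp (F.commTop A)).symm)

theorem Cell.tot_naturality {F G : PseudoMor X Y} (α : Cell F G) {Γ Δ : X.Ctx} {s : Γ ⟶ Δ}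
    {A : X.Ty.Obj Γ} {B : X.Ty.Obj Δ} (a : X.Ty.Hom s A B) :
    Y.Ty.tot (F.ty.map a) ≫ Y.Ty.tot (α.ty.app B) =
      Y.Ty.tot (α.ty.app A) ≫ Y.Ty.tot (G.ty.map a) :=
  DispCat.tot_eq (α.nat.naturality s) (α.ty.naturality a)

/-- Vertical composition of 2-cells. -/
def Cell.comp {F G H : PseudoMor X Y} (α : Cell F G) (β : Cell G H) : Cell F H where
  nat := α.nat ≫ β.nat
  ty := ⟨fun A => Y.Ty.comp (α.ty.app A) (β.ty.app A), fun a => DispCat.heq_of_tot (by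
    have e₁ := α.tot_naturality a
    have e₂ := β.tot_naturality a
    exact (Category.assoc _ _ _).symm.trans <| (congrArg (· ≫ _) e₁).trans <|
      (Category.assoc _ _ _).trans <| (congrArg (_ ≫ ·) e₂).trans (Category.assoc _ _ _).symm)⟩
  comm A := (congrArg (_ ≫ ·) (extMap_comp _ _)).trans <| (Category.assoc _ _ _).symm.trans <|
    (congrArg (· ≫ _) (α.comm A)).trans <| (Category.assoc _ _ _).trans <|
    (congrArg (_ ≫ ·) (β.comm A)).trans (Category.assoc _ _ _).symm

/-- Left whiskering. -/
def Cell.whiskerLeft (F : PseudoMor X Y) {G H : PseudoMor Y Z} (α : Cell G H) :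
    Cell (F.comp G) (F.comp H) where
  nat := Functor.whiskerLeft F.functor α.nat
  ty := ⟨fun A => α.ty.app (F.ty.obj A), fun a => α.ty.naturality (F.ty.map a)⟩
  comm A := (Category.assoc _ _ _).trans <| (congrArg (_ ≫ ·) (α.comm (F.ty.obj A))).trans <|
    (Category.assoc _ _ _).symm.trans <| (congrArg (· ≫ _) (α.nat.naturality (F.commTop A))).trans
    (Category.assoc _ _ _)

/-- Right whiskering. -/
def Cell.whiskerRight {F G : PseudoMor X Y} (α : Cell F G) (H : PseudoMor Y Z) :
    Cell (F.comp H) (G.comp H) where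
  nat := Functor.whiskerRight α.nat H.functor
  ty := ⟨fun A => H.ty.map (α.ty.app A), fun a => DispCat.heq_of_tot
    ((H.ty.tot_map_comp _ _).symm.trans ((H.ty.tot_map_congr (α.tot_naturality a)).trans
      (H.ty.tot_map_comp _ _)))⟩
  comm A := by
    have e := congrArg H.functor.map (α.comm A)
    rw [H.functor.map_comp, H.functor.map_comp] at e
    exact (Category.assoc _ _ _).trans <|
      (congrArg (_ ≫ ·) (H.commTop_naturality (α.ty.app A)).symm).trans <|
      (Category.assoc _ _ _).symm.trans <| (congrArg (· ≫ _) e).trans (Category.assoc _ _ _)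

instance : Category (PseudoMor X Y) where
  Hom F G := Cell F G
  id F := Cell.id F
  comp α β := Cell.comp α β
  id_comp α := Cell.ext (fun _ => Category.id_comp _)
    (fun A => Category.id_comp (Y.Ty.tot (α.ty.app A)))
  comp_id α := Cell.ext (fun _ => Category.comp_id _)
    (fun A => Category.comp_id (Y.Ty.tot (α.ty.app A)))
  assoc α β γ := Cell.ext (fun _ => Category.assoc _ _ _)
    (fun A => Category.assoc (Y.Ty.tot (α.ty.app A)) (Y.Ty.tot (β.ty.app A))
      (Y.Ty.tot (γ.ty.app A)))

/-- The associator. -/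
def associator (F : PseudoMor X Y) (G : PseudoMor Y Z) (H : PseudoMor Z W) :
    (F.comp G).comp H ≅ F.comp (G.comp H) where
  hom :=
    { nat := (Functor.associator F.functor G.functor H.functor).hom
      ty := ⟨fun A => W.Ty.id _, fun a => DispCat.heq_of_tot
        ((Category.comp_id (W.Ty.tot (H.ty.map (G.ty.map (F.ty.map a))))).trans
          (Category.id_comp (W.Ty.tot (H.ty.map (G.ty.map (F.ty.map a))))).symm)⟩
      comm := fun A => by
        refine (congrArg (_ ≫ ·) (extMap_id _)).trans <| (Category.comp_id _).trans <|
          Eq.trans ?_ (Category.id_comp _).symm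
        exact (congrArg (· ≫ _) (H.functor.map_comp _ _)).trans (Category.assoc _ _ _) }
  inv :=
    { nat := (Functor.associator F.functor G.functor H.functor).inv
      ty := ⟨fun A => W.Ty.id _, fun a => DispCat.heq_of_tot
        ((Category.comp_id (W.Ty.tot (H.ty.map (G.ty.map (F.ty.map a))))).trans
          (Category.id_comp (W.Ty.tot (H.ty.map (G.ty.map (F.ty.map a))))).symm)⟩
      comm := fun A => by
        refine (congrArg (_ ≫ ·) (extMap_id _)).trans <| (Category.comp_id _).trans <|
          Eq.trans ?_ (Category.id_comp _).symm
        exact ((congrArg (· ≫ _) (H.functor.map_comp _ _)).trans (Category.assoc _ _ _)).symm }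
  hom_inv_id := Cell.ext (fun _ => Category.id_comp _)
    (fun A => Category.id_comp (W.Ty.tot (W.Ty.id (H.ty.obj (G.ty.obj (F.ty.obj A))))))
  inv_hom_id := Cell.ext (fun _ => Category.id_comp _)
    (fun A => Category.id_comp (W.Ty.tot (W.Ty.id (H.ty.obj (G.ty.obj (F.ty.obj A))))))

/-- The left unitor. -/
def leftUnitor (F : PseudoMor X Y) : (PseudoMor.id X).comp F ≅ F where
  hom :=
    { nat := (Functor.leftUnitor F.functor).hom
      ty := ⟨fun _ => Y.Ty.id _, fun a => DispCat.heq_of_tot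
        ((Category.comp_id (Y.Ty.tot (F.ty.map a))).trans
          (Category.id_comp (Y.Ty.tot (F.ty.map a))).symm)⟩
      comm := fun A => (congrArg (_ ≫ ·) (extMap_id _)).trans <| (Category.comp_id _).trans <|
        congrArg (· ≫ F.commTop A) (F.functor.map_id _) }
  inv :=
    { nat := (Functor.leftUnitor F.functor).inv
      ty := ⟨fun _ => Y.Ty.id _, fun a => DispCat.heq_of_tot
        ((Category.comp_id (Y.Ty.tot (F.ty.map a))).trans
          (Category.id_comp (Y.Ty.tot (F.ty.map a))).symm)⟩
      comm := fun A => (congrArg (_ ≫ ·) (extMap_id _)).trans <| (Category.comp_id _).trans <|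
        (Category.id_comp _).symm.trans <| (Category.id_comp _).symm.trans <|
        congrArg (𝟙 _ ≫ ·) (congrArg (· ≫ F.commTop A) (F.functor.map_id _).symm) }
  hom_inv_id := Cell.ext (fun _ => Category.id_comp _)
    (fun A => Category.id_comp (Y.Ty.tot (Y.Ty.id (F.ty.obj A))))
  inv_hom_id := Cell.ext (fun _ => Category.id_comp _)
    (fun A => Category.id_comp (Y.Ty.tot (Y.Ty.id (F.ty.obj A))))

/-- The right unitor. -/
def rightUnitor (F : PseudoMor X Y) : F.comp (PseudoMor.id Y) ≅ F where
  hom :=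
    { nat := (Functor.rightUnitor F.functor).hom
      ty := ⟨fun _ => Y.Ty.id _, fun a => DispCat.heq_of_tot
        ((Category.comp_id (Y.Ty.tot (F.ty.map a))).trans
          (Category.id_comp (Y.Ty.tot (F.ty.map a))).symm)⟩
      comm := fun A => (congrArg (_ ≫ ·) (extMap_id _)).trans <| (Category.comp_id _).trans <|
        (Category.comp_id (F.commTop A)).trans (Category.id_comp (F.commTop A)).symm }
  inv :=
    { nat := (Functor.rightUnitor F.functor).inv
      ty := ⟨fun _ => Y.Ty.id _, fun a => DispCat.heq_of_tot
        ((Category.comp_id (Y.Ty.tot (F.ty.map a))).trans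
          (Category.id_comp (Y.Ty.tot (F.ty.map a))).symm)⟩
      comm := fun A => (congrArg (_ ≫ ·) (extMap_id _)).trans <| (Category.comp_id _).trans <|
        (Category.comp_id (F.commTop A)).symm.trans (Category.id_comp _).symm }
  hom_inv_id := Cell.ext (fun _ => Category.id_comp _)
    (fun A => Category.id_comp (Y.Ty.tot (Y.Ty.id (F.ty.obj A))))
  inv_hom_id := Cell.ext (fun _ => Category.id_comp _)
    (fun A => Category.id_comp (Y.Ty.tot (Y.Ty.id (F.ty.obj A))))

end

end PseudoMor

/-- The bicategory of full comprehension categories, pseudo morphisms and their 2-cells. -/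
instance : Bicategory FullCompCat.{v, u, w, z} where
  Hom X Y := PseudoMor X Y
  id X := PseudoMor.id X
  comp F G := F.comp G
  homCategory X Y := inferInstanceAs (Category (PseudoMor X Y))
  whiskerLeft F _ _ α := PseudoMor.Cell.whiskerLeft F α
  whiskerRight α H := PseudoMor.Cell.whiskerRight α H
  associator F G H := PseudoMor.associator F G H
  leftUnitor F := PseudoMor.leftUnitor F
  rightUnitor F := PseudoMor.rightUnitor F
  whiskerLeft_id F G := PseudoMor.Cell.ext (fun _ => rfl) (fun _ => rfl)
  whiskerLeft_comp F _ _ _ α β := PseudoMor.Cell.ext (fun _ => rfl) (fun _ => rfl)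
  id_whiskerLeft α := PseudoMor.Cell.ext
    (fun _ => ((Category.id_comp _).trans (Category.comp_id _)).symm)
    (fun _ => ((Category.id_comp _).trans (Category.comp_id _)).symm)
  comp_whiskerLeft F G _ _ α := PseudoMor.Cell.ext
    (fun _ => ((Category.id_comp _).trans (Category.comp_id _)).symm)
    (fun _ => ((Category.id_comp _).trans (Category.comp_id _)).symm)
  id_whiskerRight F G := PseudoMor.Cell.ext (fun _ => G.functor.map_id _)
    (fun A => G.ty.tot_map_id (F.ty.obj A))
  comp_whiskerRight α β H := PseudoMor.Cell.ext (fun _ => H.functor.map_comp _ _)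
    (fun A => H.ty.tot_map_comp (α.ty.app A) (β.ty.app A))
  whiskerRight_id α := PseudoMor.Cell.ext
    (fun _ => ((Category.id_comp _).trans (Category.comp_id _)).symm)
    (fun _ => ((Category.id_comp _).trans (Category.comp_id _)).symm)
  whiskerRight_comp α G H := PseudoMor.Cell.ext
    (fun _ => ((Category.id_comp _).trans (Category.comp_id _)).symm)
    (fun _ => ((Category.id_comp _).trans (Category.comp_id _)).symm)
  whisker_assoc F _ _ α H := PseudoMor.Cell.ext
    (fun Γ => ((Category.id_comp _).trans
      (Category.comp_id (H.functor.map (α.nat.app (F.functor.obj Γ))))).symm)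
    (fun A => ((Category.id_comp _).trans
      (Category.comp_id (DispCat.tot _ (H.ty.map (α.ty.app (F.ty.obj A)))))).symm)
  whisker_exchange α β := PseudoMor.Cell.ext
    (fun _ => (β.nat.naturality _).symm)
    (fun A => (β.tot_naturality (α.ty.app A)).symm)
  pentagon F G H I := PseudoMor.Cell.ext
    (fun Γ => by
      have e := I.functor.map_id (H.functor.obj (G.functor.obj (F.functor.obj Γ)))
      exact (congrArg (· ≫ 𝟙 _ ≫ 𝟙 _) e).trans (Category.id_comp _))
    (fun A => by
      have e := I.ty.tot_map_id (H.ty.obj (G.ty.obj (F.ty.obj A)))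
      exact (congrArg (· ≫ 𝟙 _ ≫ 𝟙 _) e).trans (Category.id_comp _))
  triangle F G := PseudoMor.Cell.ext
    (fun Γ => (Category.id_comp (𝟙 (G.functor.obj (F.functor.obj Γ)))).trans
      (G.functor.map_id (F.functor.obj Γ)).symm)
    (fun A => (Category.id_comp (DispCat.tot _ (DispCat.id _ (G.ty.obj (F.ty.obj A))))).trans
      (G.ty.tot_map_id (F.ty.obj A)).symm)

end FullCompCat

/-! ### Type formers -/

namespace FullCompCat

variable (X : FullCompCat.{v, u, w, z})

/-- Unit types: fiberwise terminal objects `1_Γ` such that the projection `Γ.1_Γ ⟶ Γ` is an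
isomorphism. -/
def HasUnitTypes : Prop :=
  X.cl.HasFiberwiseLimits (Discrete PEmpty.{1}) ∧
    ∀ (Γ : X.Ctx) (A : X.Ty.Fiber Γ), Nonempty (IsTerminal A) → IsIso (X.proj A.obj)

/-- Binary product types: fiberwise binary products. -/
def HasProductTypes : Prop := X.cl.HasFiberwiseLimits (Discrete WalkingPair)

/-- Equalizer types: fiberwise equalizers. -/
def HasEqualizerTypes : Prop := X.cl.HasFiberwiseLimits WalkingParallelPair

/-- Left adjoints to weakening: the functor `Σ_A : D[Γ.A] ⥤ D[Γ]` left adjoint to the substitution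
functor along the projection `Γ.A ⟶ Γ`, for every type `A`. -/
structure SigmaData where
  sum : {Γ : X.Ctx} → (A : X.Ty.Obj Γ) → X.Ty.Fiber (X.ext A) ⥤ X.Ty.Fiber Γ
  adj : {Γ : X.Ctx} → (A : X.Ty.Obj Γ) → sum A ⊣ X.cl.reindex (X.proj A)

variable {X}

/-- The Beck-Chevalley condition: for every pullback square
```
  Γ.A --s'--> Δ.B
   |           |
   v           v
   Γ ---s----> Δ
```
whose vertical sides are projections, the canonical transformation
`Σ_A (s'^* E) ⟶ s^* (Σ_B E)` is an isomorphism.  It is the mate of the canonical isomorphism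
`s'^* (π_B^* E) ⟶ π_A^* (s^* E)`. -/
def SigmaData.BeckChevalley (S : X.SigmaData) : Prop :=
  ∀ ⦃Γ Δ : X.Ctx⦄ (A : X.Ty.Obj Γ) (B : X.Ty.Obj Δ) (s : Γ ⟶ Δ) (s' : X.ext A ⟶ X.ext B)
    (h : IsPullback s' (X.proj A) (X.proj B) s),
    IsIso ((mateEquiv (S.adj B) (S.adj A)).symm
      (TwoSquare.mk _ _ _ _ (X.cl.squareHom (g := s') (f := X.proj B) (g' := X.proj A) (f' := s)
        h.w))).natTrans

/-- The canonical morphism `Γ.A.B ⟶ Γ.(Σ_A B)`. -/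
noncomputable def SigmaData.pairing (S : X.SigmaData) {Γ : X.Ctx} (A : X.Ty.Obj Γ)
    (B : X.Ty.Fiber (X.ext A)) : X.ext B.obj ⟶ X.ext ((S.sum A).obj B).obj :=
  X.extMap (((S.adj A).unit.app B).hom) ≫ X.extMap (X.cl.lift (X.proj A) ((S.sum A).obj B).obj)

variable (X)

/-- Strong `Σ`-types. -/
def HasStrongSigmaTypes : Prop :=
  ∃ S : X.SigmaData, S.BeckChevalley ∧
    ∀ {Γ : X.Ctx} (A : X.Ty.Obj Γ) (B : X.Ty.Fiber (X.ext A)), IsIso (S.pairing A B)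

/-- Democracy: every context is isomorphic to the extension of the empty context by a type. -/
def IsDemocratic : Prop :=
  ∀ Γ : X.Ctx, ∃ A : X.Ty.Obj (⊤_ X.Ctx), Nonempty (Γ ≅ X.ext A)

end FullCompCat

/-! ### DFL comprehension categories -/

/-- A DFL comprehension category: a democratic full comprehension category with unit types, binary
product types, equalizer types and strong `Σ`-types. -/
structure DFLCompCat where
  toFull : FullCompCat.{v, u, w, z}
  unitTypes : toFull.HasUnitTypes
  productTypes : toFull.HasProductTypes
  equalizerTypes : toFull.HasEqualizerTypes
  sigmaTypes : toFull.HasStrongSigmaTypes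
  democratic : toFull.IsDemocratic

namespace DFLCompCat

/-- A 1-cell of DFL comprehension categories: a pseudo morphism that preserves terminal objects,
binary products and equalizers in the fibers. -/
structure Mor (X Y : DFLCompCat.{v, u, w, z}) where
  toPseudo : FullCompCat.PseudoMor X.toFull Y.toFull
  preservesUnit : toPseudo.ty.PreservesFiberwiseLimits (Discrete PEmpty.{1})
  preservesProducts : toPseudo.ty.PreservesFiberwiseLimits (Discrete WalkingPair)
  preservesEqualizers : toPseudo.ty.PreservesFiberwiseLimits WalkingParallelPair

/-- 2-cells of DFL comprehension categories are the 2-cells of the underlying pseudo morphisms. -/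
@[ext]
structure Cell {X Y : DFLCompCat.{v, u, w, z}} (F G : Mor X Y) where
  cell : F.toPseudo ⟶ G.toPseudo

instance {X Y : DFLCompCat.{v, u, w, z}} : Category (Mor X Y) where
  Hom F G := Cell F G
  id F := ⟨𝟙 F.toPseudo⟩
  comp α β := ⟨α.cell ≫ β.cell⟩
  id_comp _ := Cell.ext (Category.id_comp _)
  comp_id _ := Cell.ext (Category.comp_id _)
  assoc _ _ _ := Cell.ext (Category.assoc _ _ _)

/-- An invertible 2-cell of pseudo morphisms as an invertible 2-cell. -/
def isoMk {X Y : DFLCompCat.{v, u, w, z}} {F G : Mor X Y} (e : F.toPseudo ≅ G.toPseudo) :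
    F ≅ G where
  hom := ⟨e.hom⟩
  inv := ⟨e.inv⟩
  hom_inv_id := Cell.ext e.hom_inv_id
  inv_hom_id := Cell.ext e.inv_hom_id

/-- The identity 1-cell. -/
def Mor.id (X : DFLCompCat.{v, u, w, z}) : Mor X X where
  toPseudo := FullCompCat.PseudoMor.id X.toFull
  preservesUnit := DispFunctor.PreservesFiberwiseLimits.id _ _
  preservesProducts := DispFunctor.PreservesFiberwiseLimits.id _ _
  preservesEqualizers := DispFunctor.PreservesFiberwiseLimits.id _ _

/-- Composition of 1-cells. -/
def Mor.comp {X Y Z : DFLCompCat.{v, u, w, z}} (F : Mor X Y) (G : Mor Y Z) : Mor X Z where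
  toPseudo := F.toPseudo.comp G.toPseudo
  preservesUnit := F.preservesUnit.comp G.preservesUnit
  preservesProducts := F.preservesProducts.comp G.preservesProducts
  preservesEqualizers := F.preservesEqualizers.comp G.preservesEqualizers

/-- The bicategory of DFL comprehension categories. -/
instance : Bicategory DFLCompCat.{v, u, w, z} where
  Hom X Y := Mor X Y
  id X := Mor.id X
  comp F G := F.comp G
  homCategory X Y := inferInstanceAs (Category (Mor X Y))
  whiskerLeft F _ _ α := ⟨FullCompCat.PseudoMor.Cell.whiskerLeft F.toPseudo α.cell⟩
  whiskerRight α H := ⟨FullCompCat.PseudoMor.Cell.whiskerRight α.cell H.toPseudo⟩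
  associator F G H := isoMk (FullCompCat.PseudoMor.associator F.toPseudo G.toPseudo H.toPseudo)
  leftUnitor F := isoMk (FullCompCat.PseudoMor.leftUnitor F.toPseudo)
  rightUnitor F := isoMk (FullCompCat.PseudoMor.rightUnitor F.toPseudo)
  whiskerLeft_id {X Y Z} F G := Cell.ext
    (Bicategory.whiskerLeft_id (B := FullCompCat) (a := X.toFull) (b := Y.toFull) (c := Z.toFull)
      F.toPseudo G.toPseudo)
  whiskerLeft_comp {X Y Z} F _ _ _ α β := Cell.ext
    (Bicategory.whiskerLeft_comp (B := FullCompCat) (a := X.toFull) (b := Y.toFull)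
      (c := Z.toFull) F.toPseudo α.cell β.cell)
  id_whiskerLeft {X Y} _ _ α := Cell.ext
    (Bicategory.id_whiskerLeft (B := FullCompCat) (a := X.toFull) (b := Y.toFull) α.cell)
  comp_whiskerLeft {X Y Z W} F G _ _ α := Cell.ext
    (Bicategory.comp_whiskerLeft (B := FullCompCat) (a := X.toFull) (b := Y.toFull)
      (c := Z.toFull) (d := W.toFull) F.toPseudo G.toPseudo α.cell)
  id_whiskerRight {X Y Z} F G := Cell.ext
    (Bicategory.id_whiskerRight (B := FullCompCat) (a := X.toFull) (b := Y.toFull)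
      (c := Z.toFull) F.toPseudo G.toPseudo)
  comp_whiskerRight {X Y Z} _ _ _ α β H := Cell.ext
    (Bicategory.comp_whiskerRight (B := FullCompCat) (a := X.toFull) (b := Y.toFull)
      (c := Z.toFull) α.cell β.cell H.toPseudo)
  whiskerRight_id {X Y} _ _ α := Cell.ext
    (Bicategory.whiskerRight_id (B := FullCompCat) (a := X.toFull) (b := Y.toFull) α.cell)
  whiskerRight_comp {X Y Z W} _ _ α G H := Cell.ext
    (Bicategory.whiskerRight_comp (B := FullCompCat) (a := X.toFull) (b := Y.toFull)
      (c := Z.toFull) (d := W.toFull) α.cell G.toPseudo H.toPseudo)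
  whisker_assoc {X Y Z W} F _ _ α H := Cell.ext
    (Bicategory.whisker_assoc (B := FullCompCat) (a := X.toFull) (b := Y.toFull)
      (c := Z.toFull) (d := W.toFull) F.toPseudo α.cell H.toPseudo)
  whisker_exchange {X Y Z} _ _ _ _ α β := Cell.ext
    (Bicategory.whisker_exchange (B := FullCompCat) (a := X.toFull) (b := Y.toFull)
      (c := Z.toFull) α.cell β.cell)
  pentagon {X Y Z W V} F G H I := Cell.ext
    (Bicategory.pentagon (B := FullCompCat) (a := X.toFull) (b := Y.toFull)
      (c := Z.toFull) (d := W.toFull) (e := V.toFull) F.toPseudo G.toPseudo H.toPseudo I.toPseudo)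
  triangle {X Y Z} F G := Cell.ext
    (Bicategory.triangle (B := FullCompCat) (a := X.toFull) (b := Y.toFull)
      (c := Z.toFull) F.toPseudo G.toPseudo)

/-- The functor between the categories of contexts underlying a 1-cell. -/
abbrev base {X Y : DFLCompCat.{v, u, w, z}} (F : X ⟶ Y) : X.toFull.Ctx ⥤ Y.toFull.Ctx :=
  (show Mor X Y from F).toPseudo.functor

/-- The displayed functor between the displayed categories of types underlying a 1-cell. -/
abbrev onTypes {X Y : DFLCompCat.{v, u, w, z}} (F : X ⟶ Y) :
    DispFunctor (base F) X.toFull.Ty Y.toFull.Ty :=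
  (show Mor X Y from F).toPseudo.ty

end DFLCompCat

/-- A 1-cell `f` of a bicategory is an adjoint equivalence if it is the left adjoint of an
adjunction whose unit and counit are invertible. -/
def IsAdjointEquivalence {B : Type u} [Bicategory.{w, v} B] {a b : B} (f : a ⟶ b) : Prop :=
  ∃ (g : b ⟶ a) (adj : Bicategory.Adjunction f g), IsIso adj.unit ∧ IsIso adj.counit

end DFL

/-!
The inverse 1-cell has `G` and `Gbar`, the given inverses of `F` and `Fbar`, as its underlying
functor and displayed functor.  It has to be shown that these form a 1-cell and that the given
units and counits are 2-cells; the triangle laws and the invertibility are then inherited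
componentwise.

* A displayed adjunction is an adjunction `∫ Fbar ⊣ ∫ Gbar` between total categories that lies over
  `F ⊣ G` (`DispAdjointEquivalence.totalAdj`).  Transposing factorisation problems along it shows
  that `Gbar`, being a displayed right adjoint, preserves Cartesian morphisms
  (`DispAdjointEquivalence.inverse_isCartesian`).
* `∫ Gbar` is an equivalence and `G` is faithful, so the functors between fibers induced by `Gbar`
  are fully faithful; they are essentially surjective because `A` over `G y` can be recovered from
  the substitution of `Fbar A` along the inverse of the counit at `y`.  Being equivalences, they
  preserve all limits (`DispAdjointEquivalence.inverse_preservesFiberwiseLimits`).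
* The comparison `G (Δ.B) ⟶ (G Δ).(Gbar B)` is the inverse of the transpose of the composite
  `F ((G Δ).(Gbar B)) ⟶ (F G Δ).(Fbar Gbar B) ⟶ Δ.B` of the comparison of `F` with the displayed
  counit (`FullCompCat.PseudoMor.inverseComparison`).  With this choice, compatibility of the counit
  is the definition of a transpose, and compatibility of the unit is the left triangle law
  (`FullCompCat.PseudoMor.map_extUnit_comp`).
-/

namespace DFL

/-! ### Displayed isomorphisms and total categories -/

section Total

variable {C : Type u} [Category.{v} C] {D : DispCat.{v, u, w, z} C}

theorem DispCat.IsIsoOver.isIso_tot {x y : C} {f : x ⟶ y} [IsIso f] {A : D.Obj x} {B : D.Obj y}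
    {a : D.Hom f A B} (h : DispCat.IsIsoOver a) : IsIso (D.tot a) := by
  obtain ⟨b, h₁, h₂⟩ := h
  exact ⟨D.tot b, DispCat.tot_eq (IsIso.hom_inv_id f) h₁, DispCat.tot_eq (IsIso.inv_hom_id f) h₂⟩

/-- The inverse in the total category of a displayed isomorphism over `f` can be taken to lie over
`inv f` on the nose. -/
theorem DispCat.IsIsoOver.exists_tot_eq_inv {x y : C} {f : x ⟶ y} [IsIso f] {A : D.Obj x}
    {B : D.Obj y} {a : D.Hom f A B} (h : DispCat.IsIsoOver a) :
    ∃ b : D.Hom (inv f) B A, D.tot a ≫ D.tot b = 𝟙 _ ∧ D.tot b ≫ D.tot a = 𝟙 _ := by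
  obtain ⟨b, h₁, h₂⟩ := h
  exact ⟨b, DispCat.tot_eq (IsIso.hom_inv_id f) h₁, DispCat.tot_eq (IsIso.inv_hom_id f) h₂⟩

/-- Cartesian morphisms in terms of the total category. -/
theorem DispCat.isCartesian_iff_total {x y : C} {f : x ⟶ y} {A : D.Obj x} {B : D.Obj y}
    (a : D.Hom f A B) : DispCat.IsCartesian a ↔
      ∀ (T : D.Total) (g : T.base ⟶ x) (h : T ⟶ ⟨y, B⟩), h.base = g ≫ f →
        ∃! k : T ⟶ ⟨x, A⟩, k.base = g ∧ k ≫ D.tot a = h := by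
  constructor
  · rintro ha ⟨t, E⟩ g ⟨_, h⟩ rfl
    obtain ⟨k, hk, hu⟩ := ha E g h
    refine ⟨D.tot k, ⟨rfl, congrArg D.tot hk⟩, ?_⟩
    rintro ⟨_, k'⟩ ⟨rfl, hk'⟩
    exact congrArg D.tot (hu k' (DispCat.eq_of_tot hk'))
  · intro ha t E g h
    obtain ⟨⟨_, k⟩, ⟨rfl, hk⟩, hu⟩ := ha ⟨t, E⟩ g (D.tot h) rfl
    exact ⟨k, DispCat.eq_of_tot hk, fun k' hk' =>
      DispCat.eq_of_tot (hu (D.tot k') ⟨rfl, congrArg D.tot hk'⟩)⟩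

/-- A Cartesian morphism over an isomorphism is invertible. -/
theorem DispCat.IsCartesian.isIso_tot {x y : C} {f : x ⟶ y} [IsIso f] {A : D.Obj x}
    {B : D.Obj y} {a : D.Hom f A B} (h : DispCat.IsCartesian a) : IsIso (D.tot a) := by
  have e₁ : D.tot (h.fac (inv f) (D.tr (IsIso.inv_hom_id f).symm (D.id B))) ≫ D.tot a = 𝟙 _ :=
    (h.fac_comp _ _).trans ((DispCat.tot_tr _ _).trans (DispCat.tot_id B))
  refine ⟨D.tot (h.fac (inv f) (D.tr (IsIso.inv_hom_id f).symm (D.id B))), ?_, e₁⟩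
  have e₂ := congrArg D.tot (h.hom_ext (g := 𝟙 x) (k' := D.id A)
    (k := D.tr (IsIso.hom_inv_id f)
      (D.comp a (h.fac (inv f) (D.tr (IsIso.inv_hom_id f).symm (D.id B)))))
    (by rw [DispCat.tot_tr, DispCat.tot_comp, Category.assoc, e₁, DispCat.tot_id,
      Category.comp_id, Category.id_comp]))
  rwa [DispCat.tot_tr, DispCat.tot_comp, DispCat.tot_id] at e₂

/-- A vertical morphism is an isomorphism in the fiber as soon as it is one in the total
category. -/
theorem DispCat.isIso_fiber {x : C} {A B : D.Fiber x} (a : A ⟶ B) (h : IsIso (D.tot a.hom)) :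
    IsIso a := by
  have hb : (inv (D.tot a.hom)).base = 𝟙 x := by
    have := congrArg DispCat.TotalHom.base (IsIso.hom_inv_id (D.tot a.hom))
    exact (Category.id_comp _).symm.trans this
  have ht : D.tot (D.tr hb (inv (D.tot a.hom)).fib) = inv (D.tot a.hom) := DispCat.tot_tr _ _
  refine ⟨⟨D.tr hb (inv (D.tot a.hom)).fib⟩, DispCat.fiber_ext ?_, DispCat.fiber_ext ?_⟩
  · rw [DispCat.tot_fiber_comp, ht, IsIso.hom_inv_id, DispCat.tot_fiber_id]
  · rw [DispCat.tot_fiber_comp, ht, IsIso.inv_hom_id, DispCat.tot_fiber_id]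

end Total

/-! ### Displayed adjoint equivalences -/

section Functors

variable {C₁ : Type u₁} [Category.{v₁} C₁] {C₂ : Type u₂} [Category.{v₂} C₂]
  {D₁ : DispCat.{v₁, u₁, w₁, z₁} C₁} {D₂ : DispCat.{v₂, u₂, w₂, z₂} C₂}

/-- The functor between total categories induced by a displayed functor. -/
def DispFunctor.total {F : C₁ ⥤ C₂} (P : DispFunctor F D₁ D₂) : D₁.Total ⥤ D₂.Total where
  obj A := ⟨F.obj A.base, P.obj A.fib⟩
  map a := ⟨F.map a.base, P.map a.fib⟩
  map_id A := P.tot_map_id A.fib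
  map_comp a b := P.tot_map_comp a.fib b.fib

theorem DispNatTrans.tot_naturality {F G : C₁ ⥤ C₂} {τ : F ⟶ G} {P : DispFunctor F D₁ D₂}
    {Q : DispFunctor G D₁ D₂} (α : DispNatTrans τ P Q) {x y : C₁} {f : x ⟶ y} {A : D₁.Obj x}
    {B : D₁.Obj y} (a : D₁.Hom f A B) :
    D₂.tot (P.map a) ≫ D₂.tot (α.app B) = D₂.tot (α.app A) ≫ D₂.tot (Q.map a) :=
  DispCat.tot_eq (τ.naturality f) (α.naturality a)

namespace DispAdjointEquivalence

variable {F : C₁ ⥤ C₂} {P : DispFunctor F D₁ D₂} {e : AdjointEquivalence F}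
  (d : DispAdjointEquivalence P e)

theorem tot_left_triangle {x : C₁} (A : D₁.Obj x) :
    D₂.tot (P.map (d.unit.app A)) ≫ D₂.tot (d.counit.app (P.obj A)) = 𝟙 _ :=
  DispCat.tot_eq (e.adj.left_triangle_components x) (d.left_triangle A)

theorem tot_right_triangle {y : C₂} (B : D₂.Obj y) :
    D₁.tot (d.unit.app (d.inverse.obj B)) ≫ D₁.tot (d.inverse.map (d.counit.app B)) = 𝟙 _ :=
  DispCat.tot_eq (e.adj.right_triangle_components y) (d.right_triangle B)

/-- The adjunction between total categories induced by a displayed adjoint equivalence. -/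
def totalAdj : P.total ⊣ d.inverse.total :=
  Adjunction.mkOfUnitCounit
    { unit :=
        { app := fun A => D₁.tot (d.unit.app A.fib)
          naturality := fun _ _ a => d.unit.tot_naturality a.fib }
      counit :=
        { app := fun B => D₂.tot (d.counit.app B.fib)
          naturality := fun _ _ b => d.counit.tot_naturality b.fib }
      left_triangle := by
        ext A
        exact (congrArg (_ ≫ ·) (Category.id_comp _)).trans (d.tot_left_triangle A.fib)
      right_triangle := by
        ext B
        exact (congrArg (_ ≫ ·) (Category.id_comp _)).trans (d.tot_right_triangle B.fib) }

/-- Transposition in the total categories lies over transposition in the base. -/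
theorem homEquiv_base {T : D₁.Total} {S : D₂.Total} (k : P.total.obj T ⟶ S) :
    (d.totalAdj.homEquiv T S k).base = e.adj.homEquiv T.base S.base k.base :=
  (congrArg DispCat.TotalHom.base (Adjunction.homEquiv_unit ..)).trans
    (Adjunction.homEquiv_unit ..).symm

theorem homEquiv_symm_base {T : D₁.Total} {S : D₂.Total} (h : T ⟶ d.inverse.total.obj S) :
    ((d.totalAdj.homEquiv T S).symm h).base = (e.adj.homEquiv T.base S.base).symm h.base :=
  (congrArg DispCat.TotalHom.base (Adjunction.homEquiv_counit ..)).trans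
    (Adjunction.homEquiv_counit ..).symm

theorem isIso_totalAdj_unit_app (A : D₁.Total) : IsIso (d.totalAdj.unit.app A) :=
  (d.unit_isIso A.fib).isIso_tot

theorem isIso_totalAdj_counit_app (B : D₂.Total) : IsIso (d.totalAdj.counit.app B) :=
  (d.counit_isIso B.fib).isIso_tot

theorem isEquivalence_total_inverse : d.inverse.total.IsEquivalence := by
  have := d.isIso_totalAdj_unit_app
  have := d.isIso_totalAdj_counit_app
  exact d.totalAdj.toEquivalence.isEquivalence_inverse

theorem faithful_base_inverse : e.inverse.Faithful := e.adj.faithful_R_of_epi_counit_app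

/-- The inverse is a displayed right adjoint, hence it preserves Cartesian morphisms: a
factorisation problem for the image of `b` is the transpose of one for `b`. -/
theorem inverse_isCartesian : d.inverse.IsCartesian := by
  intro x y f A B b hb
  rw [DispCat.isCartesian_iff_total] at hb ⊢
  intro T g h hbase
  have hbase' : ((d.totalAdj.homEquiv T ⟨y, B⟩).symm h).base =
      (e.adj.homEquiv T.base x).symm g ≫ f := by
    refine (d.homEquiv_symm_base (S := ⟨y, B⟩) h).trans ?_
    rw [hbase]
    exact e.adj.homEquiv_naturality_right_symm g f
  obtain ⟨k, ⟨hk₁, hk₂⟩, hu⟩ := hb (P.total.obj T) _ _ hbase'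
  refine ⟨d.totalAdj.homEquiv T ⟨x, A⟩ k, ⟨?_, ?_⟩, fun l ⟨hl₁, hl₂⟩ => ?_⟩
  · refine (d.homEquiv_base k).trans ?_
    rw [hk₁]
    exact Equiv.apply_symm_apply _ _
  · refine (d.totalAdj.homEquiv_naturality_right k (D₂.tot b)).symm.trans ?_
    exact (congrArg _ hk₂).trans (Equiv.apply_symm_apply _ _)
  · refine (Equiv.symm_apply_eq _).1 (hu ((d.totalAdj.homEquiv T ⟨x, A⟩).symm l) ⟨?_, ?_⟩)
    · refine (d.homEquiv_symm_base (S := ⟨x, A⟩) l).trans ?_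
      rw [hl₁]
    · exact (d.totalAdj.homEquiv_naturality_right_symm l (D₂.tot b)).symm.trans (congrArg _ hl₂)

/-- The inverse induces equivalences between fibers.  An object `A` over `G y`, where `G` is the
inverse of the base functor, comes from the substitution of `P A` along the inverse of the counit
at `y`. -/
theorem isEquivalence_fiber_inverse (cl : D₂.Cleaving) (y : C₂) :
    (d.inverse.fiber y).IsEquivalence := by
  have := d.isEquivalence_total_inverse
  have : e.inverse.Faithful := faithful_base_inverse
  refine { faithful := ⟨?_⟩, full := ⟨?_⟩, essSurj := ⟨?_⟩ }
  · intro A B a b h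
    refine DispCat.fiber_ext (d.inverse.total.map_injective ?_)
    have := congrArg (fun c => D₁.tot (DispCat.FiberHom.hom c)) h
    exact (DispCat.tot_tr _ _).symm.trans (this.trans (DispCat.tot_tr _ _))
  · intro A B a
    let b := d.inverse.total.preimage (X := ⟨y, A.obj⟩) (Y := ⟨y, B.obj⟩) (D₁.tot a.hom)
    have hb : d.inverse.total.map b = D₁.tot a.hom := d.inverse.total.map_preimage _
    have hbase : b.base = 𝟙 y := e.inverse.map_injective
      ((congrArg DispCat.TotalHom.base hb).trans (e.inverse.map_id y).symm)
    refine ⟨⟨D₂.tr hbase b.fib⟩, DispCat.fiber_ext ((DispCat.tot_tr _ _).trans ?_)⟩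
    exact (d.inverse.tot_map_congr (DispCat.tot_tr _ _)).trans hb
  · intro A
    -- the isomorphism `c` from the image of the substitution to `A` is the image of the lift,
    -- followed by the inverse of the unit; it is vertical by the right triangle law
    let l : (⟨y, cl.obj (inv (e.adj.counit.app y)) (P.obj A.obj)⟩ : D₂.Total) ⟶
        P.total.obj ⟨_, A.obj⟩ := D₂.tot (cl.lift (inv (e.adj.counit.app y)) (P.obj A.obj))
    have hl : IsIso l := (cl.cart _ _).isIso_tot
    let u : (⟨_, A.obj⟩ : D₁.Total) ⟶ d.inverse.total.obj (P.total.obj ⟨_, A.obj⟩) :=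
      d.totalAdj.unit.app ⟨_, A.obj⟩
    have : IsIso u := d.isIso_totalAdj_unit_app ⟨_, A.obj⟩
    let c := d.inverse.total.map l ≫ inv u
    have hc : c.base = 𝟙 (e.inverse.obj y) := by
      have h₁ : c ≫ u = d.inverse.total.map l := by simp [c]
      have h₂ : c.base ≫ e.adj.unit.app (e.inverse.obj y) =
          e.inverse.map (inv (e.adj.counit.app y)) := congrArg DispCat.TotalHom.base h₁
      have h₃ : e.inverse.map (inv (e.adj.counit.app y)) = e.adj.unit.app (e.inverse.obj y) :=
        (Functor.map_inv _ _).trans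
          (IsIso.inv_eq_of_inv_hom_id (e.adj.right_triangle_components y))
      exact (cancel_mono (e.adj.unit.app (e.inverse.obj y))).1
        (h₂.trans (h₃.trans (Category.id_comp _).symm))
    let c' : (d.inverse.fiber y).obj ⟨cl.obj (inv (e.adj.counit.app y)) (P.obj A.obj)⟩ ⟶ A :=
      ⟨D₁.tr hc c.fib⟩
    have hc' : D₁.tot c'.hom = c := DispCat.tot_tr _ _
    have hci : IsIso c := inferInstanceAs (IsIso (_ ≫ _))
    have : IsIso c' := DispCat.isIso_fiber _ (by rwa [hc'])
    exact ⟨_, ⟨asIso c'⟩⟩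

theorem inverse_preservesFiberwiseLimits (cl : D₂.Cleaving) (J : Type) [SmallCategory J] :
    d.inverse.PreservesFiberwiseLimits J := fun y =>
  have := d.isEquivalence_fiber_inverse cl y
  inferInstance

end DispAdjointEquivalence

end Functors

/-! ### Invertible 2-cells -/

namespace FullCompCat.PseudoMor

variable {X : FullCompCat.{v₁, u₁, w₁, z₁}} {Y : FullCompCat.{v₂, u₂, w₂, z₂}}

/-- A 2-cell whose components are invertible is invertible. -/
theorem Cell.isIso {F G : PseudoMor X Y} (α : F ⟶ G) [IsIso (Cell.nat α)]
    (h : (Cell.ty α).IsIsoOver) : IsIso α := by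
  choose b hb₁ hb₂ using fun {Γ : X.Ctx} (A : X.Ty.Obj Γ) => (h A).exists_tot_eq_inv
  have hn : ∀ Γ, inv ((Cell.nat α).app Γ) = (inv (Cell.nat α)).app Γ := fun Γ =>
    (NatIso.isIso_inv_app _ _).symm
  -- the displayed inverses lie over the inverses of the components, and are transported to the
  -- components of the inverse
  let β : Cell G F :=
    { nat := inv (Cell.nat α)
      ty := ⟨fun {Γ} A => Y.Ty.tr (hn Γ) (b A), fun {Γ Δ s A B} a => DispCat.heq_of_tot (by
        rw [DispCat.tot_comp, DispCat.tot_comp, DispCat.tot_tr, DispCat.tot_tr]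
        have := (h A).isIso_tot
        have := (h B).isIso_tot
        rw [← cancel_epi (Y.Ty.tot ((Cell.ty α).app A)),
          ← cancel_mono (Y.Ty.tot ((Cell.ty α).app B))]
        simp only [Category.assoc, hb₂, reassoc_of% (hb₁ A)]
        rw [Category.comp_id]
        exact (Cell.tot_naturality α a).symm)⟩
      comm := fun {Γ} A => by
        have e₁ : Y.extMap ((Cell.ty α).app A) ≫ Y.extMap (Y.Ty.tr (hn Γ) (b A)) = 𝟙 _ :=
          (extMap_comp _ _).symm.trans ((extMap_congr
            ((congrArg (_ ≫ ·) (DispCat.tot_tr _ _)).trans (hb₁ A))).trans (extMap_id _))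
        rw [← cancel_epi ((Cell.nat α).app (X.ext A)), ← Category.assoc, ← Cell.comm α A,
          Category.assoc, e₁, Category.comp_id, ← Category.assoc, ← NatTrans.comp_app,
          IsIso.hom_inv_id, NatTrans.id_app, Category.id_comp] }
  refine ⟨β, Cell.ext (fun Γ => ?_) (fun A => ?_), Cell.ext (fun Γ => ?_) (fun A => ?_)⟩
  · exact congrArg (fun τ : F.functor ⟶ F.functor => τ.app Γ) (IsIso.hom_inv_id (Cell.nat α))
  · exact (congrArg (_ ≫ ·) (DispCat.tot_tr _ _)).trans (hb₁ A)
  · exact congrArg (fun τ : G.functor ⟶ G.functor => τ.app Γ) (IsIso.inv_hom_id (Cell.nat α))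
  · exact (congrArg (· ≫ _) (DispCat.tot_tr _ _)).trans (hb₂ A)

/-! ### The inverse pseudo morphism -/

section Inverse

variable (F : PseudoMor X Y) {e : AdjointEquivalence F.functor}
  (d : DispAdjointEquivalence F.ty e)

theorem isIso_extMap {Γ Δ : Y.Ctx} {s : Γ ⟶ Δ} {A : Y.Ty.Obj Γ} {B : Y.Ty.Obj Δ}
    (a : Y.Ty.Hom s A B) [IsIso s] (h : DispCat.IsIsoOver a) : IsIso (Y.extMap a) := by
  obtain ⟨b, h₁, h₂⟩ := h.exists_tot_eq_inv
  exact ⟨Y.extMap b, (extMap_comp _ _).symm.trans ((extMap_congr h₁).trans (extMap_id _)),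
    (extMap_comp _ _).symm.trans ((extMap_congr h₂).trans (extMap_id _))⟩

/-- The morphism `(F G Δ).(F G B) ⟶ Δ.B` induced by the displayed counit, where `G` stands for
both the inverse functor and the inverse displayed functor. -/
def extCounit {Δ : Y.Ctx} (B : Y.Ty.Obj Δ) : Y.ext (F.ty.obj (d.inverse.obj B)) ⟶ Y.ext B :=
  Y.extMap (d.counit.app B)

/-- The morphism `Γ.A ⟶ (G F Γ).(G F A)` induced by the displayed unit. -/
def extUnit {Γ : X.Ctx} (A : X.Ty.Obj Γ) : X.ext A ⟶ X.ext (d.inverse.obj (F.ty.obj A)) :=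
  X.extMap (d.unit.app A)

instance {Δ : Y.Ctx} (B : Y.Ty.Obj Δ) : IsIso (F.extCounit d B) :=
  isIso_extMap _ (d.counit_isIso B)

theorem extCounit_proj {Δ : Y.Ctx} (B : Y.Ty.Obj Δ) :
    F.extCounit d B ≫ Y.proj B = Y.proj (F.ty.obj (d.inverse.obj B)) ≫ e.adj.counit.app Δ :=
  extMap_proj _

theorem extCounit_naturality {Γ Δ : Y.Ctx} {s : Γ ⟶ Δ} {A : Y.Ty.Obj Γ} {B : Y.Ty.Obj Δ}
    (a : Y.Ty.Hom s A B) :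
    Y.extMap (F.ty.map (d.inverse.map a)) ≫ F.extCounit d B =
      F.extCounit d A ≫ Y.extMap a :=
  (extMap_comp _ _).symm.trans ((extMap_congr (d.counit.tot_naturality a)).trans (extMap_comp _ _))

/-- The left triangle law on comprehensions, by naturality of the comparison of `F`. -/
theorem map_extUnit_comp {Γ : X.Ctx} (A : X.Ty.Obj Γ) :
    F.functor.map (F.extUnit d A) ≫ F.commTop (d.inverse.obj (F.ty.obj A)) ≫
      F.extCounit d (F.ty.obj A) = F.commTop A := by
  have h₁ : F.functor.map (F.extUnit d A) ≫ F.commTop (d.inverse.obj (F.ty.obj A)) =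
      F.commTop A ≫ Y.extMap (F.ty.map (d.unit.app A)) := F.commTop_naturality (d.unit.app A)
  have h₂ : Y.extMap (F.ty.map (d.unit.app A)) ≫ F.extCounit d (F.ty.obj A) = 𝟙 _ :=
    (extMap_comp _ _).symm.trans ((extMap_congr (d.tot_left_triangle A)).trans (extMap_id _))
  refine (Category.assoc _ _ _).symm.trans ((congrArg (· ≫ _) h₁).trans ?_)
  exact (Category.assoc _ _ _).trans ((congrArg (_ ≫ ·) h₂).trans (Category.comp_id _))

/-- The morphism `(G Δ).(G B) ⟶ G (Δ.B)`, transpose of the composite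
`F ((G Δ).(G B)) ⟶ (F G Δ).(F G B) ⟶ Δ.B` of the comparison of `F` and the counit.  Its inverse
is the comparison of the inverse pseudo morphism. -/
def inverseComparison {Δ : Y.Ctx} (B : Y.Ty.Obj Δ) :
    X.ext (d.inverse.obj B) ⟶ e.inverse.obj (Y.ext B) :=
  e.adj.homEquiv (X.ext (d.inverse.obj B)) (Y.ext B)
    (F.commTop (d.inverse.obj B) ≫ F.extCounit d B)

instance {Δ : Y.Ctx} (B : Y.Ty.Obj Δ) : IsIso (F.inverseComparison d B) := by
  rw [inverseComparison, Adjunction.homEquiv_unit]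
  infer_instance

theorem inverseComparison_proj {Δ : Y.Ctx} (B : Y.Ty.Obj Δ) :
    F.inverseComparison d B ≫ e.inverse.map (Y.proj B) = X.proj (d.inverse.obj B) := by
  rw [inverseComparison, ← Adjunction.homEquiv_naturality_right, Category.assoc, extCounit_proj,
    ← Category.assoc, commTop_proj, Adjunction.homEquiv_naturality_left,
    Adjunction.homEquiv_unit]
  exact (congrArg (_ ≫ ·) (e.adj.right_triangle_components Δ)).trans (Category.comp_id _)

theorem inverseComparison_naturality {Γ Δ : Y.Ctx} {s : Γ ⟶ Δ} {A : Y.Ty.Obj Γ}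
    {B : Y.Ty.Obj Δ} (a : Y.Ty.Hom s A B) :
    F.inverseComparison d A ≫ e.inverse.map (Y.extMap a) =
      X.extMap (d.inverse.map a) ≫ F.inverseComparison d B := by
  rw [inverseComparison, inverseComparison, ← Adjunction.homEquiv_naturality_right,
    ← Adjunction.homEquiv_naturality_left, Category.assoc, ← extCounit_naturality,
    ← Category.assoc, ← Category.assoc, F.commTop_naturality]

/-- The inverse of a pseudo morphism along a displayed adjoint equivalence. -/
noncomputable def inverse : PseudoMor Y X where
  functor := e.inverse
  preservesTerminal := have := e.adj.rightAdjoint_preservesLimits; inferInstance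
  ty := d.inverse
  cartesian := d.inverse_isCartesian
  comm := mkComm d.inverse (fun B => inv (F.inverseComparison d B))
    (fun B => by rw [IsIso.inv_comp_eq, inverseComparison_proj])
    (fun {_ _ _ A B} a => ((IsIso.eq_inv_comp (F.inverseComparison d A)).2
      ((Category.assoc _ _ _).symm.trans ((IsIso.comp_inv_eq (F.inverseComparison d B)).2
        (F.inverseComparison_naturality d a)))))
  comm_isIso := mkComm_isIso _ _ _ _ (fun _ => inferInstance)

/-- Compatibility of the unit with the comparisons, with that of the inverse moved to the other
side. -/
theorem extUnit_comp_inverseComparison {Γ : X.Ctx} (A : X.Ty.Obj Γ) :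
    F.extUnit d A ≫ F.inverseComparison d (F.ty.obj A) =
      e.adj.homEquiv (X.ext A) (Y.ext (F.ty.obj A)) (F.commTop A) := by
  rw [inverseComparison, ← Adjunction.homEquiv_naturality_left, map_extUnit_comp]

/-- Compatibility of the counit with the comparisons, with that of the inverse moved to the other
side. -/
theorem map_inverseComparison_comp {Δ : Y.Ctx} (B : Y.Ty.Obj Δ) :
    F.functor.map (F.inverseComparison d B) ≫ e.adj.counit.app (Y.ext B) =
      F.commTop (d.inverse.obj B) ≫ F.extCounit d B := by
  refine (e.adj.homEquiv_counit ..).symm.trans ?_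
  exact Equiv.symm_apply_apply _ _

/-- The unit of the adjoint equivalence as a 2-cell. -/
noncomputable def unitCell : PseudoMor.id X ⟶ F.comp (F.inverse d) :=
  Cell.mk (F := PseudoMor.id X) (G := F.comp (F.inverse d)) e.adj.unit d.unit fun {Γ} A => by
    have h := (IsIso.eq_comp_inv _).2 (F.extUnit_comp_inverseComparison d A)
    rw [Adjunction.homEquiv_unit] at h
    exact (Category.id_comp (F.extUnit d A)).trans (h.trans (Category.assoc _ _ _))

/-- The counit of the adjoint equivalence as a 2-cell. -/
noncomputable def counitCell : (F.inverse d).comp F ⟶ PseudoMor.id Y :=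
  Cell.mk (F := (F.inverse d).comp F) (G := PseudoMor.id Y) e.adj.counit d.counit fun {Δ} B => by
    have h : (F.functor.map (inv (F.inverseComparison d B)) ≫ F.commTop (d.inverse.obj B)) ≫
        F.extCounit d B = e.adj.counit.app (Y.ext B) := by
      rw [Category.assoc, ← map_inverseComparison_comp, Functor.map_inv, IsIso.inv_hom_id_assoc]
    exact h.trans (Category.comp_id _).symm

theorem isIso_unitCell : IsIso (F.unitCell d) :=
  have : IsIso (Cell.nat (F.unitCell d)) := e.unit_isIso
  Cell.isIso _ d.unit_isIso

theorem isIso_counitCell : IsIso (F.counitCell d) :=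
  have : IsIso (Cell.nat (F.counitCell d)) := e.counit_isIso
  Cell.isIso _ d.counit_isIso

end Inverse

end FullCompCat.PseudoMor

/-! ### The adjunction of 1-cells -/

section Bicategory

open Bicategory

variable {B : Type u} [Bicategory.{w, v} B] {a b : B} {f : a ⟶ b} {g : b ⟶ a}

theorem leftZigzag_eq (η : 𝟙 a ⟶ f ≫ g) (θ : g ≫ f ⟶ 𝟙 b) :
    leftZigzag η θ = η ▷ f ≫ (α_ f g f).hom ≫ f ◁ θ := by
  simp [leftZigzag, bicategoricalComp]

theorem rightZigzag_eq (η : 𝟙 a ⟶ f ≫ g) (θ : g ≫ f ⟶ 𝟙 b) :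
    rightZigzag η θ = g ◁ η ≫ (α_ g f g).inv ≫ θ ▷ g := by
  simp [rightZigzag, bicategoricalComp]

end Bicategory

namespace DFLCompCat

variable {X Y : DFLCompCat.{v, u, w, z}} (F : X ⟶ Y) {e : AdjointEquivalence (base F)}
  (d : DispAdjointEquivalence (onTypes F) e)

/-- The inverse of a 1-cell along a displayed adjoint equivalence. -/
noncomputable def inverse : Y ⟶ X :=
  Mor.mk (X := Y) (Y := X) (FullCompCat.PseudoMor.inverse (Mor.toPseudo F) d)
    (d.inverse_preservesFiberwiseLimits Y.toFull.cl _)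
    (d.inverse_preservesFiberwiseLimits Y.toFull.cl _)
    (d.inverse_preservesFiberwiseLimits Y.toFull.cl _)

/-- The adjunction of 1-cells induced by a displayed adjoint equivalence. -/
noncomputable def adjunction : Bicategory.Adjunction F (inverse F d) where
  unit := Cell.mk (F := Mor.id X) (G := Mor.comp F (inverse F d))
    (FullCompCat.PseudoMor.unitCell (Mor.toPseudo F) d)
  counit := Cell.mk (F := Mor.comp (inverse F d) F) (G := Mor.id Y)
    (FullCompCat.PseudoMor.counitCell (Mor.toPseudo F) d)
  left_triangle := by
    rw [leftZigzag_eq]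
    refine Cell.ext (FullCompCat.PseudoMor.Cell.ext (fun Γ => ?_) (fun A => ?_))
    · exact (congrArg (_ ≫ ·) (Category.id_comp _)).trans
        ((e.adj.left_triangle_components Γ).trans (Category.id_comp _).symm)
    · exact (congrArg (_ ≫ ·) (Category.id_comp _)).trans
        ((d.tot_left_triangle A).trans (Category.id_comp _).symm)
  right_triangle := by
    rw [rightZigzag_eq]
    refine Cell.ext (FullCompCat.PseudoMor.Cell.ext (fun Δ => ?_) (fun B => ?_))
    · exact (congrArg (_ ≫ ·) (Category.id_comp _)).trans
        ((e.adj.right_triangle_components Δ).trans (Category.id_comp _).symm)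
    · exact (congrArg (_ ≫ ·) (Category.id_comp _)).trans
        ((d.tot_right_triangle B).trans (Category.id_comp _).symm)

theorem isIso_of_isIso_cell {F G : Mor X Y} (α : F ⟶ G) (h : IsIso (Cell.cell α)) : IsIso α :=
  (isoMk (asIso (Cell.cell α))).isIso_hom

end DFLCompCat

end DFL

theorem mainTheorem6 {X Y : DFL.DFLCompCat.{v, u, w, z}} (F : X ⟶ Y)
    (e : DFL.AdjointEquivalence (DFL.DFLCompCat.base F))
    (d : DFL.DispAdjointEquivalence (DFL.DFLCompCat.onTypes F) e) :
    DFL.IsAdjointEquivalence F := by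
  exact ⟨DFL.DFLCompCat.inverse F d, DFL.DFLCompCat.adjunction F d,
    DFL.DFLCompCat.isIso_of_isIso_cell _ (DFL.FullCompCat.PseudoMor.isIso_unitCell _ d),
    DFL.DFLCompCat.isIso_of_isIso_cell _ (DFL.FullCompCat.PseudoMor.isIso_counitCell _ d)⟩
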